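/- **Setting.** Let $d\ge1$ be an integer, $\alpha\ge0$, $\beta,L,c_0,r_0,C_0>0$ and $0<\mu_{\min}<\mu_{\max}$. Let $(X,Y)$ have law $P$ on $\mathbb R^d\times\{0,1\}$, let $P_X$ be the law of $X$, $\eta(x)=P(Y=1\mid X=x)$ the regression function (defined $P_X$-a.e.), $R(f)=P(Y\ne f(X))$ for Borel $f:\mathbb R^d\to\{0,1\}$, and $f^*=\mathbf 1_{\{\eta\ge1/2\}}$. Let $(X_1,Y_1),\dots,(X_n,Y_n)$ be i.i.d. with law $P$, and let $\mathbb E$ be the expectation over this sample. Let $\lfloor\beta\rfloor$ denote the largest integer strictly less than $\beta$, $\lambda$ the Lebesgue measure, $\|\cdot\|$ the Euclidean norm, and $\mathcal B(x,r)$ the closed ball. **Class of distributions.** For a compact $\mathcal C\subset\mathbb R^d$, let $\mathcal P_\Sigma$ be the class of all $P$ such that, for some version of $\eta$: 1. (margin assumption) $P_X(0<|\eta(X)-1/2|\le t)\le C_0t^\alpha$ for all $t>0$; 2. (Hölder class $\Sigma(\beta,L,\mathbb R^d)$) $\eta:\mathbb R^d\to\mathbb R$ is $\lfloor\beta\rfloor$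 times continuously differentiable and $|\eta(x')-\eta_x(x')|\le L\|x-x'\|^\beta$ for all $x,x'\in\mathbb R^d$, where $\eta_x$ is the Taylor polynomial of $\eta$ of degree $\lfloor\beta\rfloor$ at $x$; 3. (strong density assumption) there is a compact set $A\subseteq\mathcal C$ with $\lambda[A\cap\mathcal B(x,r)]\ge c_0\lambda[\mathcal B(x,r)]$ for all $0<r\le r_0$ and $x\in A$, such that $P_X$ has a Lebesgue density $\mu$ with $\mu_{\min}\le\mu\le\mu_{\max}$ on $A$ and $\mu=0$ off $A$. **Estimator.** Let $K:\mathbb R^d\to[0,\infty)$ be a Borel kernel such that, for some $c>0$, $K(x)\ge c\,\mathbf 1_{\{\|x\|\le c\}}$ for all $x$; $\int K=1$; $\int(1+\|u\|^{4\beta})K^2(u)\,du<\infty$; $\sup_u(1+\|u\|^{2\beta})K(u)<\infty$; and $\int\|u\|^{\beta+\lfloor\beta\rfloor}K(u)\,du<\infty$. For $h>0$ let $\hat\eta^{LP}(x)=\hat\theta_x(0)$ if the polynomial $\hat\theta_x$ is the unique minimizer of $\sum_{i=1}^n[Y_i-\theta(X_i-x)]^2K\big(\frac{X_i-x}h\big)$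 over polynomials $\theta$ on $\mathbb R^d$ of degree at most $\lfloor\beta\rfloor$, and $\hat\eta^{LP}(x)=0$ if there is no unique minimizer. Let $\bar\Omega$ be the matrix indexed by the multi-indices $|s_1|,|s_2|\le\lfloor\beta\rfloor$ with entries $$\bar\Omega_{s_1,s_2}=\frac1{nh^d}\sum_{i=1}^n\Big(\frac{X_i-x}h\Big)^{s_1+s_2}K\Big(\frac{X_i-x}h\Big).$$ Let $\hat\eta^*(x)$ be the projection of $\hat\eta^{LP}(x)$ on $[0,1]$ if the smallest eigenvalue of $\bar\Omega$ is greater than $(\log n)^{-1}$ (read as $+\infty$ for $n=1$), and $\hat\eta^*(x)=0$ otherwise. Let $\hat f_n^*=\mathbf 1_{\{\hat\eta^*\ge1/2\}}$ with bandwidth $h=n^{-1/(2\beta+d)}$. **Theorem.** For every $n\ge1$ the classifier $\hat f_n^*(x)$ is jointly measurable in the sample and in $x$. There is a constant $C>0$, depending only on $\alpha,C_0,\beta,d,L,c_0,r_0,\mu_{\min},\mu_{\max}$ and $K$, such that for every compact $\mathcal C\subset\mathbb R^d$ and every $n\ge1$, $$\sup_{P\in\mathcal P_\Sigma}\big\{\mathbb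 E R(\hat f_n^*)-R(f^*)\big\}\le C\,n^{-\frac{\beta(1+\alpha)}{2\beta+d}}.$$ Moreover, the rate $n^{-\beta(1+\alpha)/(2\beta+d)}$ is $o(1/n)$ if and only if $(\alpha-1)\beta>d$. -/

import Mathlib

open MeasureTheory ProbabilityTheory Filter Asymptotics

noncomputable section

namespace PlugIn

/-- The feature space `ℝ^d` with its Euclidean norm. -/
abbrev E (d : ℕ) : Type := EuclideanSpace ℝ (Fin d)

/-- The space `ℝ^d × {0,1}` of labelled observations. -/
abbrev Z (d : ℕ) : Type := E d × Fin 2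

/-! ### Multi-indices, polynomials, Hölder classes -/

/-- Multi-indices `s ∈ ℕ^d` with `|s| = s_1 + ⋯ + s_d ≤ l`. -/
abbrev MultiIdx (d l : ℕ) : Type := {s : Fin d → ℕ // ∑ i, s i ≤ l}

instance instFintypeMultiIdx (d l : ℕ) : Fintype (MultiIdx d l) :=
  Fintype.ofInjective
    (fun (s : MultiIdx d l) (i : Fin d) =>
      (⟨s.1 i, Nat.lt_succ_of_le
        ((Finset.single_le_sum (fun _ _ => Nat.zero_le _) (Finset.mem_univ i)).trans s.2)⟩ :
          Fin (l + 1)))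
    (by
      intro s t h
      apply Subtype.ext
      funext i
      exact congrArg Fin.val (congrFun h i))

/-- The monomial `u^s = u_1^{s_1} ⋯ u_d^{s_d}`. -/
def mono {d : ℕ} (u : E d) (s : Fin d → ℕ) : ℝ := ∏ i, u i ^ s i

/-- The value at `u` of the polynomial of degree at most `l` with coefficients `T`. -/
def polyEval {d l : ℕ} (T : MultiIdx d l → ℝ) (u : E d) : ℝ := ∑ s, T s * mono u s.1

/-- The partial derivative `∂g/∂x_i`. -/
def partialD {d : ℕ} (i : Fin d) (g : E d → ℝ) : E d → ℝ :=
  fun x => lineDeriv ℝ g x (EuclideanSpace.single i 1)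

/-- The differential operator `D^s = ∂^{s_1 + ⋯ + s_d} / ∂x_1^{s_1} ⋯ ∂x_d^{s_d}`. -/
def multiD {d : ℕ} (s : Fin d → ℕ) (g : E d → ℝ) : E d → ℝ :=
  (List.finRange d).foldr (fun i φ => (partialD i)^[s i] φ) g

/-- `⌊β⌋`, the maximal integer strictly less than `β` (for `β > 0`). -/
def floorLT (β : ℝ) : ℕ := ⌈β⌉₊ - 1

/-- `g_x(x')`, where `g_x` is the Taylor polynomial of `g` of degree `l` at the point `x`. -/
def taylorPoly {d : ℕ} (l : ℕ) (g : E d → ℝ) (x x' : E d) : ℝ :=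
  ∑ s : MultiIdx d l, mono (x' - x) s.1 / (∏ i, (Nat.factorial (s.1 i) : ℝ)) * multiD s.1 g x

/-- The Hölder class `Σ(β, L, ℝ^d)`. -/
def holderClass (d : ℕ) (β L : ℝ) : Set (E d → ℝ) :=
  {g | ContDiff ℝ (floorLT β) g ∧
    ∀ x x' : E d, |g x' - taylorPoly (floorLT β) g x x'| ≤ L * ‖x - x'‖ ^ β}

/-! ### The class of distributions -/

/-- `(c₀, r₀)`-regular sets. -/
def IsRegularSet {d : ℕ} (c₀ r₀ : ℝ) (A : Set (E d)) : Prop :=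
  NullMeasurableSet A volume ∧
    ∀ r : ℝ, 0 < r → r ≤ r₀ → ∀ x ∈ A,
      ENNReal.ofReal c₀ * volume (Metric.closedBall x r) ≤ volume (A ∩ Metric.closedBall x r)

/-- The strong density assumption on the marginal distribution `PX`. -/
def StrongDensity {d : ℕ} (c₀ r₀ μmin μmax : ℝ) (C : Set (E d)) (PX : Measure (E d)) : Prop :=
  ∃ A : Set (E d), A ⊆ C ∧ IsCompact A ∧ IsRegularSet c₀ r₀ A ∧
    ∃ μ : E d → ℝ, Measurable μ ∧ (∀ x ∈ A, μmin ≤ μ x ∧ μ x ≤ μmax) ∧ (∀ x ∉ A, μ x = 0) ∧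
      PX = volume.withDensity (fun x => ENNReal.ofReal (μ x))

/-- `P(Y = 1 | X = x)`, computed from the regular conditional distribution of `Y` given `X`. -/
def regressionFun {d : ℕ} (P : Measure (Z d)) [IsFiniteMeasure P] (x : E d) : ℝ :=
  (P.condKernel x).real {1}

/-- `η` is a version of the regression function `x ↦ P(Y = 1 | X = x)`. -/
def IsRegressionFun {d : ℕ} (P : Measure (Z d)) [IsFiniteMeasure P] (η : E d → ℝ) : Prop :=
  η =ᵐ[P.fst] regressionFun P

/-- The margin assumption with constants `C₀` and `α`. -/
def MarginAssumption {d : ℕ} (C₀ α : ℝ) (PX : Measure (E d)) (η : E d → ℝ) : Prop :=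
  ∀ t : ℝ, 0 < t → PX.real {x | 0 < |η x - 1 / 2| ∧ |η x - 1 / 2| ≤ t} ≤ C₀ * t ^ α

/-- The class `𝒫_Σ` of distributions of `(X, Y)`. The regression function is determined up to
`P_X`-null sets; membership asks for a version that lies in the Hölder class on all of `ℝ^d`. -/
def classP (d : ℕ) (α β L c₀ r₀ C₀ μmin μmax : ℝ) (C : Set (E d)) :
    Set (ProbabilityMeasure (Z d)) :=
  {P | (∃ η : E d → ℝ, IsRegressionFun (P : Measure (Z d)) η ∧ η ∈ holderClass d β L ∧
          MarginAssumption C₀ α (P : Measure (Z d)).fst η) ∧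
        StrongDensity c₀ r₀ μmin μmax C (P : Measure (Z d)).fst}

/-! ### Classifiers and risks -/

/-- The decision rule `x ↦ 1{η(x) ≥ 1/2}`. -/
def plugIn {d : ℕ} (η : E d → ℝ) (x : E d) : Fin 2 :=
  open Classical in if 1 / 2 ≤ η x then 1 else 0

/-- The misclassification error `R(f) = P(Y ≠ f(X))`. -/
def risk {d : ℕ} (P : Measure (Z d)) (f : E d → Fin 2) : ℝ :=
  P.real {z | z.2 ≠ f z.1}

/-- The Bayes rule `f^*`. -/
def bayesRule {d : ℕ} (P : Measure (Z d)) [IsFiniteMeasure P] : E d → Fin 2 :=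
  plugIn (regressionFun P)

/-- The excess risk `𝔼 R(f̂) - R(f^*)` of an empirical decision rule `f̂` based on an i.i.d.
sample of size `n` from `P`. -/
def excessRisk {d n : ℕ} (P : Measure (Z d)) [IsFiniteMeasure P]
    (f : (Fin n → Z d) → E d → Fin 2) : ℝ :=
  (∫ ω, risk P (f ω) ∂(Measure.pi fun _ : Fin n => P)) - risk P (bayesRule P)

/-! ### The local polynomial estimator -/

/-- Kernels admitted for the smoothness `β`. -/
structure IsKernel {d : ℕ} (β : ℝ) (K : E d → ℝ) : Prop where
  measurable : Measurable K
  nonneg : ∀ u, 0 ≤ K u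
  lower : ∃ c : ℝ, 0 < c ∧ ∀ u, ‖u‖ ≤ c → c ≤ K u
  integrable : Integrable K
  integral_eq_one : ∫ u, K u = 1
  integrable_sq : Integrable fun u => (1 + ‖u‖ ^ (4 * β)) * K u ^ 2
  bounded : ∃ M : ℝ, ∀ u, (1 + ‖u‖ ^ (2 * β)) * K u ≤ M
  moment : Integrable fun u => ‖u‖ ^ (β + floorLT β) * K u

/-- The label `Y ∈ {0,1}` as a real number. -/
def label (y : Fin 2) : ℝ := ((y : ℕ) : ℝ)

/-- The local least squares criterion
`∑ᵢ (Yᵢ - θ(Xᵢ - x))² K((Xᵢ - x)/h)` for the polynomial `θ` with coefficients `T`. -/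
def lpCriterion {d n l : ℕ} (K : E d → ℝ) (h : ℝ) (ω : Fin n → Z d) (x : E d)
    (T : MultiIdx d l → ℝ) : ℝ :=
  ∑ i, (label (ω i).2 - polyEval T ((ω i).1 - x)) ^ 2 * K (h⁻¹ • ((ω i).1 - x))

/-- `T` is the unique minimizer of the local least squares criterion. -/
def IsUniqueMinimizer {d n l : ℕ} (K : E d → ℝ) (h : ℝ) (ω : Fin n → Z d) (x : E d)
    (T : MultiIdx d l → ℝ) : Prop :=
  ∀ T' : MultiIdx d l → ℝ, T' ≠ T → lpCriterion K h ω x T < lpCriterion K h ω x T'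

/-- The local polynomial estimator of order `l`: the value at `0` of the unique minimizing
polynomial if there is one, and `0` otherwise. -/
def lpEstimator {d n : ℕ} (l : ℕ) (K : E d → ℝ) (h : ℝ) (ω : Fin n → Z d) (x : E d) : ℝ :=
  open Classical in
  if H : ∃ T : MultiIdx d l → ℝ, IsUniqueMinimizer K h ω x T then polyEval H.choose 0 else 0

/-- The matrix `Ω̄` with entries
`(n h^d)⁻¹ ∑ᵢ ((Xᵢ - x)/h)^{s₁ + s₂} K((Xᵢ - x)/h)`, for `|s₁|, |s₂| ≤ l`. -/
def omegaBar {d n : ℕ} (l : ℕ) (K : E d → ℝ) (h : ℝ) (ω : Fin n → Z d) (x : E d) :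
    Matrix (MultiIdx d l) (MultiIdx d l) ℝ :=
  fun s₁ s₂ => 1 / (n * h ^ d) *
    ∑ i, mono (h⁻¹ • ((ω i).1 - x)) (s₁.1 + s₂.1) * K (h⁻¹ • ((ω i).1 - x))

theorem omegaBar_isHermitian {d n : ℕ} (l : ℕ) (K : E d → ℝ) (h : ℝ) (ω : Fin n → Z d)
    (x : E d) : (omegaBar l K h ω x).IsHermitian := by
  ext s₁ s₂
  simp [omegaBar, add_comm]

/-- The smallest eigenvalue of `Ω̄`. -/
def minEigenvalue {d n : ℕ} (l : ℕ) (K : E d → ℝ) (h : ℝ) (ω : Fin n → Z d) (x : E d) : ℝ :=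
  ⨅ s, (omegaBar_isHermitian l K h ω x).eigenvalues s

/-- The estimator `η̂^*`: the projection on `[0,1]` of the local polynomial estimator of order
`⌊β⌋` if the smallest eigenvalue of `Ω̄` exceeds `1 / log n`, and `0` otherwise. For `n = 1` the
threshold `1 / log n` is `+∞`. -/
def etaStar {d n : ℕ} (β : ℝ) (K : E d → ℝ) (h : ℝ) (ω : Fin n → Z d) (x : E d) : ℝ :=
  open Classical in
  if 1 < n ∧ (Real.log n)⁻¹ < minEigenvalue (floorLT β) K h ω x then
    max 0 (min 1 (lpEstimator (floorLT β) K h ω x))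
  else 0

/-- The plug-in classifier `f̂_n^* = 1{η̂^* ≥ 1/2}` with bandwidth `h = n^{-1/(2β+d)}`. -/
def fStar {d : ℕ} (n : ℕ) (β : ℝ) (K : E d → ℝ) (ω : Fin n → Z d) : E d → Fin 2 :=
  plugIn (etaStar β K ((n : ℝ) ^ (-(1 / (2 * β + d)))) ω)

end PlugIn

end

open PlugIn

/-!
The estimator `η̂^*(x)` is analysed at a fixed point `x` of the support, and the pointwise bound is
then integrated against the margin condition.

*Pointwise bound.* In the rescaled variables `Uᵢ = (Xᵢ - x)/h` the local least squares problem has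
the Gram matrix `Ω̄`, and the difference of its solution and the rescaled Taylor coefficients `T`
of `η` at `x` solves a linear system with matrix `Ω̄` and right-hand side
`W = (n h^d)⁻¹ ∑ᵢ (Yᵢ - T(Uᵢ)) Uᵢ^s K(Uᵢ)`. So a lower bound on the quadratic form of `Ω̄` and an
upper bound on `W` control `|η̂^*(x) - η(x)|` (`abs_etaStar_sub_le`). Three facts give these bounds:

* `𝔼 Ω̄` is uniformly positive definite (`le_quadForm_mean`). By the strong density assumption the
  law of `U` dominates `μmin h^d` times Lebesgue measure on a subset of the ball of radius `c` with
  a fixed proportion of its volume; zero sets of polynomials are null, so by compactness of the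
  unit sphere of coefficients, squared integrals of polynomials over such subsets are uniformly
  bounded below (`exists_le_setIntegral_sq`).
* `𝔼 W` is of order `h^β`, by the Hölder condition (`abs_mean_residual_le`).
* The entries of `Ω̄` and of `W` are averages of functions dominated by a multiple of
  `(1 + |u|^{2β}) K(u)`, which are bounded and have second moment `O(h^d)`; a Bernstein inequality
  gives deviations `ε` with probability at most `2 exp(-r n h^d ε²)` (`exists_concentration`).

Since `n h^d = h^{-2β}` for the chosen bandwidth, a wrong decision at `x` has probability at most
`C₁ exp(-c₂ (|η(x) - 1/2| / h^β)²)` (`exists_pointwise_bound`).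

*Integration.* The excess risk is the integral of `|2η(x) - 1|` times the probability of a wrong
decision at `x` (`excessRisk_eq`). Cutting the range of `|η - 1/2| / h^β` into unit shells and using
the margin assumption on each shell yields `O(h^{β(1+α)})` (`integral_le_of_margin`). Finitely many
small `n` are absorbed in the constant.

Joint measurability holds because, where the smallest eigenvalue of `Ω̄` exceeds the threshold, the
estimator is the constant coefficient of `Ω̄⁻¹ a`, with `a` the right-hand side of the normal
equations (`lpEstimator_eq`), and elsewhere `η̂^*` vanishes.
-/

noncomputable section

namespace PlugIn

/-! ### Monomials and polynomials -/

theorem mono_add {d : ℕ} (u : E d) (s t : Fin d → ℕ) : mono u (s + t) = mono u s * mono u t := by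
  simp [mono, pow_add, Finset.prod_mul_distrib]

theorem mono_smul {d : ℕ} (h : ℝ) (u : E d) (s : Fin d → ℕ) :
    mono (h • u) s = h ^ (∑ i, s i) * mono u s := by
  simp [mono, mul_pow, Finset.prod_mul_distrib, Finset.prod_pow_eq_pow_sum]

theorem abs_mono_le {d : ℕ} (u : E d) (s : Fin d → ℕ) : |mono u s| ≤ ‖u‖ ^ (∑ i, s i) := by
  rw [mono, Finset.abs_prod, ← Finset.prod_pow_eq_pow_sum]
  refine Finset.prod_le_prod (fun i _ => abs_nonneg _) fun i _ => ?_
  rw [abs_pow]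
  exact pow_le_pow_left₀ (abs_nonneg _) (PiLp.norm_apply_le u i) _

@[fun_prop]
theorem continuous_mono {d : ℕ} (s : Fin d → ℕ) : Continuous fun u : E d => mono u s := by
  unfold mono
  fun_prop

@[fun_prop]
theorem continuous_polyEval {d l : ℕ} :
    Continuous fun p : (MultiIdx d l → ℝ) × E d => polyEval p.1 p.2 := by
  unfold polyEval mono
  fun_prop

/-- The multi-index `0`. -/
def zeroIdx (d l : ℕ) : MultiIdx d l := ⟨0, by simp⟩

instance (d l : ℕ) : Nonempty (MultiIdx d l) := ⟨zeroIdx d l⟩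

theorem polyEval_zero {d l : ℕ} (T : MultiIdx d l → ℝ) : polyEval T 0 = T (zeroIdx d l) := by
  rw [polyEval, Finset.sum_eq_single (zeroIdx d l)]
  · simp [mono, zeroIdx]
  · intro s _ hs
    have : ∃ i, s.1 i ≠ 0 := by
      by_contra! h
      exact hs (Subtype.ext (funext h))
    obtain ⟨i, hi⟩ := this
    have : mono (0 : E d) s.1 = 0 := Finset.prod_eq_zero (Finset.mem_univ i) (by simp [hi])
    simp [this]
  · simp

theorem polyEval_smul {d l : ℕ} (T : MultiIdx d l → ℝ) (h : ℝ) (u : E d) :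
    polyEval T (h • u) = polyEval (fun s => h ^ (∑ i, s.1 i) * T s) u := by
  simp only [polyEval, mono_smul]
  exact Finset.sum_congr rfl fun s _ => by ring

theorem polyEval_sub {d l : ℕ} (S T : MultiIdx d l → ℝ) (u : E d) :
    polyEval (S - T) u = polyEval S u - polyEval T u := by
  simp [polyEval, sub_mul, Finset.sum_sub_distrib]

theorem polyEval_sq {d l : ℕ} (w : MultiIdx d l → ℝ) (u : E d) :
    polyEval w u ^ 2 = ∑ s, ∑ t, w s * w t * mono u (s.1 + t.1) := by
  rw [polyEval, sq, Finset.sum_mul_sum]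
  refine Finset.sum_congr rfl fun s _ => Finset.sum_congr rfl fun t _ => ?_
  rw [mono_add]
  ring

/-! ### Quadratic forms and the smallest eigenvalue -/

/-- The quadratic form `w ↦ w · M w`, written as a double sum. -/
def quadForm {ι : Type*} [Fintype ι] (M : ι → ι → ℝ) (w : ι → ℝ) : ℝ :=
  ∑ s, ∑ t, w s * w t * M s t

theorem quadForm_eq_dotProduct {ι : Type*} [Fintype ι] (M : Matrix ι ι ℝ) (w : ι → ℝ) :
    quadForm M w = w ⬝ᵥ M.mulVec w := by
  simp only [quadForm, dotProduct, Matrix.mulVec, Finset.mul_sum]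
  exact Finset.sum_congr rfl fun s _ => Finset.sum_congr rfl fun t _ => by ring

/-- The smallest eigenvalue of a symmetric matrix is at least `t` iff its quadratic form dominates
`t |w|²`. -/
theorem le_iInf_eigenvalues_iff {ι : Type*} [Fintype ι] [DecidableEq ι] [Nonempty ι]
    {A : Matrix ι ι ℝ} (hA : A.IsHermitian) (t : ℝ) :
    t ≤ ⨅ s, hA.eigenvalues s ↔ ∀ w : ι → ℝ, t * ∑ s, w s ^ 2 ≤ quadForm A w := by
  have hB : (A - t • (1 : Matrix ι ι ℝ)).IsHermitian := by
    refine hA.sub ?_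
    ext i j
    simp [Matrix.one_apply, eq_comm]
  have hspec : ∀ r, r ∈ spectrum ℝ A ↔ r - t ∈ spectrum ℝ (A - t • (1 : Matrix ι ι ℝ)) := by
    intro r
    rw [← Algebra.algebraMap_eq_smul_one, ← spectrum.sub_singleton_eq]
    simp
  have h1 : t ≤ ⨅ s, hA.eigenvalues s ↔ ∀ s, t ≤ hA.eigenvalues s :=
    le_ciInf_iff (Set.finite_range _).bddBelow
  have h2 : (∀ s, t ≤ hA.eigenvalues s) ↔ (A - t • (1 : Matrix ι ι ℝ)).PosSemidef := by
    rw [hB.posSemidef_iff_eigenvalues_nonneg]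
    constructor
    · intro h s
      have := hB.eigenvalues_mem_spectrum_real s
      have h3 := (hspec (hB.eigenvalues s + t)).2 (by simpa using this)
      rw [hA.spectrum_real_eq_range_eigenvalues] at h3
      obtain ⟨s', hs'⟩ := h3
      have := h s'
      simp only [Pi.zero_apply]
      linarith
    · intro h s
      have h3 := (hspec _).1 (hA.eigenvalues_mem_spectrum_real s)
      rw [hB.spectrum_real_eq_range_eigenvalues] at h3
      obtain ⟨s', hs'⟩ := h3
      have : 0 ≤ hB.eigenvalues s' := h s'
      linarith
  rw [h1, h2, Matrix.posSemidef_iff_dotProduct_mulVec]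
  have h4 : ∀ w : ι → ℝ, star w ⬝ᵥ (A - t • (1 : Matrix ι ι ℝ)).mulVec w =
      quadForm A w - t * ∑ s, w s ^ 2 := by
    intro w
    rw [quadForm_eq_dotProduct, Matrix.sub_mulVec, Matrix.smul_mulVec, Matrix.one_mulVec,
      dotProduct_sub, dotProduct_smul]
    simp [dotProduct, sq]
  simp only [h4, sub_nonneg, hB, true_and]

theorem le_minEigenvalue_iff {d n l : ℕ} (K : E d → ℝ) (h : ℝ) (ω : Fin n → Z d) (x : E d)
    (t : ℝ) : t ≤ minEigenvalue l K h ω x ↔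
      ∀ w, t * ∑ s, w s ^ 2 ≤ quadForm (omegaBar l K h ω x) w :=
  le_iInf_eigenvalues_iff _ _

/-! ### The local least squares problem -/

theorem quadForm_omegaBar {d n l : ℕ} (K : E d → ℝ) (h : ℝ) (ω : Fin n → Z d) (x : E d)
    (w : MultiIdx d l → ℝ) : quadForm (omegaBar l K h ω x) w = 1 / (n * h ^ d) *
      ∑ i, polyEval w (h⁻¹ • ((ω i).1 - x)) ^ 2 * K (h⁻¹ • ((ω i).1 - x)) := by
  simp only [quadForm, omegaBar, polyEval_sq, Finset.mul_sum, Finset.sum_mul]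
  conv_rhs => rw [Finset.sum_comm]
  refine Finset.sum_congr rfl fun s _ => ?_
  conv_rhs => rw [Finset.sum_comm]
  exact Finset.sum_congr rfl fun t _ => Finset.sum_congr rfl fun i _ => by ring

/-- The right-hand side `(n h^d)⁻¹ ∑ᵢ Yᵢ Uᵢ^s K(Uᵢ)`, `Uᵢ = (Xᵢ - x)/h`, of the normal
equations. -/
def lpRhs {d n : ℕ} (l : ℕ) (K : E d → ℝ) (h : ℝ) (ω : Fin n → Z d) (x : E d)
    (s : MultiIdx d l) : ℝ :=
  1 / (n * h ^ d) *
    ∑ i, label (ω i).2 * mono (h⁻¹ • ((ω i).1 - x)) s.1 * K (h⁻¹ • ((ω i).1 - x))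

/-- The residual `(n h^d)⁻¹ ∑ᵢ (Yᵢ - T(Uᵢ)) Uᵢ^s K(Uᵢ)`, `Uᵢ = (Xᵢ - x)/h`, of the normal
equations at the polynomial with coefficients `T`. -/
def lpResidual {d n l : ℕ} (K : E d → ℝ) (h : ℝ) (ω : Fin n → Z d) (x : E d)
    (T : MultiIdx d l → ℝ) (s : MultiIdx d l) : ℝ :=
  1 / (n * h ^ d) *
    ∑ i, (label (ω i).2 - polyEval T (h⁻¹ • ((ω i).1 - x))) *
      mono (h⁻¹ • ((ω i).1 - x)) s.1 * K (h⁻¹ • ((ω i).1 - x))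

theorem lpResidual_eq {d n l : ℕ} (K : E d → ℝ) (h : ℝ) (ω : Fin n → Z d) (x : E d)
    (T : MultiIdx d l → ℝ) :
    lpResidual K h ω x T = lpRhs l K h ω x - (omegaBar l K h ω x).mulVec T := by
  funext s
  simp only [lpResidual, lpRhs, Pi.sub_apply, Matrix.mulVec, dotProduct, omegaBar, Finset.mul_sum,
    Finset.sum_mul, polyEval, sub_mul, mul_sub, Finset.sum_sub_distrib]
  congr 1
  rw [Finset.sum_comm]
  refine Finset.sum_congr rfl fun t _ => Finset.sum_congr rfl fun i _ => ?_
  rw [mono_add]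
  ring

/-- When `Ω̄` is positive definite, the local polynomial estimator is the constant coefficient of
the solution of the normal equations in the rescaled variable. -/
theorem lpEstimator_eq {d n l : ℕ} (K : E d → ℝ) {h : ℝ} (hh : 0 < h) (hn : 0 < n)
    (ω : Fin n → Z d) (x : E d)
    (hpos : ∀ w : MultiIdx d l → ℝ, w ≠ 0 → 0 < quadForm (omegaBar l K h ω x) w)
    {T : MultiIdx d l → ℝ} (hT : lpResidual K h ω x T = 0) :
    lpEstimator l K h ω x = T (zeroIdx d l) := by
  have hnh : (0 : ℝ) < n * h ^ d := by positivity
  -- the solution in the original variable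
  set T₀ : MultiIdx d l → ℝ := fun s => (h ^ (∑ i, s.1 i))⁻¹ * T s with hT₀
  have hscale : ∀ (S : MultiIdx d l → ℝ) (v : E d),
      polyEval S v = polyEval (fun s => h ^ (∑ i, s.1 i) * S s) (h⁻¹ • v) := by
    intro S v
    rw [← polyEval_smul, smul_inv_smul₀ hh.ne']
  have hT₀' : ∀ v, polyEval T₀ v = polyEval T (h⁻¹ • v) := by
    intro v
    rw [hscale]
    congr 1
    funext s
    have : h ^ (∑ i, s.1 i) ≠ 0 := by positivity
    simp [hT₀, this]
  have hmin : IsUniqueMinimizer K h ω x T₀ := by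
    intro T' hne
    set D : MultiIdx d l → ℝ := fun s => h ^ (∑ i, s.1 i) * (T' s - T₀ s) with hD
    have hD0 : D ≠ 0 := by
      intro h0
      apply hne
      funext s
      have := congrFun h0 s
      have hp : h ^ (∑ i, s.1 i) ≠ 0 := by positivity
      simp only [hD, Pi.zero_apply, mul_eq_zero, hp, false_or] at this
      linarith
    have hT' : ∀ v, polyEval T' v = polyEval T (h⁻¹ • v) + polyEval D (h⁻¹ • v) := by
      intro v
      have h1 : polyEval (T' - T₀) v = polyEval D (h⁻¹ • v) := by rw [hscale]; rfl
      rw [← h1, polyEval_sub, hT₀']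
      ring
    have hq := hpos D hD0
    rw [quadForm_omegaBar] at hq
    have hq' : 0 < ∑ i, polyEval D (h⁻¹ • ((ω i).1 - x)) ^ 2 * K (h⁻¹ • ((ω i).1 - x)) :=
      pos_of_mul_pos_right hq (by positivity)
    -- the cross term vanishes by the normal equations
    have hcross : ∑ i, (label (ω i).2 - polyEval T (h⁻¹ • ((ω i).1 - x))) *
        polyEval D (h⁻¹ • ((ω i).1 - x)) * K (h⁻¹ • ((ω i).1 - x)) = 0 := by
      have h1 : ∀ s : MultiIdx d l, ∑ i, (label (ω i).2 - polyEval T (h⁻¹ • ((ω i).1 - x))) *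
          mono (h⁻¹ • ((ω i).1 - x)) s.1 * K (h⁻¹ • ((ω i).1 - x)) = 0 := by
        intro s
        have := congrFun hT s
        simp only [lpResidual, Pi.zero_apply, mul_eq_zero] at this
        exact this.resolve_left (by positivity)
      have h2 : ∑ s, D s * ∑ i, (label (ω i).2 - polyEval T (h⁻¹ • ((ω i).1 - x))) *
          mono (h⁻¹ • ((ω i).1 - x)) s.1 * K (h⁻¹ • ((ω i).1 - x)) = 0 := by simp [h1]
      rw [← h2]
      simp only [Finset.mul_sum]
      rw [Finset.sum_comm]
      refine Finset.sum_congr rfl fun i _ => ?_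
      conv_lhs => rw [polyEval.eq_def D, Finset.mul_sum, Finset.sum_mul]
      exact Finset.sum_congr rfl fun s _ => by ring
    have hsum : lpCriterion K h ω x T' = lpCriterion K h ω x T₀ -
        2 * (∑ i, (label (ω i).2 - polyEval T (h⁻¹ • ((ω i).1 - x))) *
          polyEval D (h⁻¹ • ((ω i).1 - x)) * K (h⁻¹ • ((ω i).1 - x))) +
        ∑ i, polyEval D (h⁻¹ • ((ω i).1 - x)) ^ 2 * K (h⁻¹ • ((ω i).1 - x)) := by
      simp only [lpCriterion, Finset.mul_sum]
      rw [← Finset.sum_sub_distrib, ← Finset.sum_add_distrib]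
      refine Finset.sum_congr rfl fun i _ => ?_
      rw [hT', hT₀']
      ring
    rw [hsum, hcross]
    linarith
  have hex : ∃ T : MultiIdx d l → ℝ, IsUniqueMinimizer K h ω x T := ⟨T₀, hmin⟩
  have hch : hex.choose = T₀ := by
    by_contra hne
    exact lt_asymm (hmin _ hne) (hex.choose_spec _ (Ne.symm hne))
  rw [lpEstimator, dif_pos hex, hch, hT₀', smul_zero, polyEval_zero]

theorem quadForm_pos_of_lt {ι : Type*} [Fintype ι] {M : ι → ι → ℝ} {t : ℝ} (ht : 0 < t)
    (hM : ∀ w, t * ∑ s, w s ^ 2 ≤ quadForm M w) {w : ι → ℝ} (hw : w ≠ 0) : 0 < quadForm M w := by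
  refine lt_of_lt_of_le (mul_pos ht ?_) (hM w)
  obtain ⟨s, hs⟩ := Function.ne_iff.1 hw
  exact Finset.sum_pos' (fun _ _ => sq_nonneg _)
    ⟨s, Finset.mem_univ s, by simpa using sq_pos_of_ne_zero hs⟩

theorem isUnit_det_of_quadForm_pos {ι : Type*} [Fintype ι] [DecidableEq ι] {M : Matrix ι ι ℝ}
    (hM : ∀ w, w ≠ 0 → 0 < quadForm M w) : IsUnit M.det := by
  rw [isUnit_iff_ne_zero]
  intro h0
  obtain ⟨v, hv, hv0⟩ := Matrix.exists_mulVec_eq_zero_iff.2 h0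
  have := hM v hv
  rw [quadForm_eq_dotProduct, hv0] at this
  simp at this

theorem lpResidual_inv_mulVec {d n l : ℕ} (K : E d → ℝ) (h : ℝ) (ω : Fin n → Z d) (x : E d)
    (hpos : ∀ w : MultiIdx d l → ℝ, w ≠ 0 → 0 < quadForm (omegaBar l K h ω x) w) :
    lpResidual K h ω x ((omegaBar l K h ω x)⁻¹.mulVec (lpRhs l K h ω x)) = 0 := by
  rw [lpResidual_eq, Matrix.mulVec_mulVec,
    Matrix.mul_nonsing_inv _ (isUnit_det_of_quadForm_pos hpos), Matrix.one_mulVec, sub_self]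

/-- If a matrix has smallest eigenvalue at least `t`, then a solution `e` of `M e = W` is bounded
by `|W|_∞` up to the factor `card ι / t`. -/
theorem abs_le_of_mulVec_eq {ι : Type*} [Fintype ι] {M : Matrix ι ι ℝ} {t ε : ℝ}
    (ht : 0 < t) (hM : ∀ w, t * ∑ s, w s ^ 2 ≤ quadForm M w) {e W : ι → ℝ}
    (he : M.mulVec e = W) (hW : ∀ s, |W s| ≤ ε) (s : ι) :
    |e s| ≤ Fintype.card ι * ε / t := by
  obtain ⟨m, -, hm⟩ := Finset.exists_max_image Finset.univ (fun s => |e s|) ⟨s, Finset.mem_univ s⟩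
  refine (hm s (Finset.mem_univ s)).trans ?_
  have hε : 0 ≤ ε := (abs_nonneg _).trans (hW s)
  have h1 : t * |e m| ^ 2 ≤ Fintype.card ι * ε * |e m| := by
    calc t * |e m| ^ 2 ≤ t * ∑ s, e s ^ 2 := by
          refine mul_le_mul_of_nonneg_left ?_ ht.le
          rw [sq_abs]
          exact Finset.single_le_sum (f := fun s => e s ^ 2) (fun _ _ => sq_nonneg _)
            (Finset.mem_univ m)
      _ ≤ e ⬝ᵥ W := by rw [← he, ← quadForm_eq_dotProduct]; exact hM e
      _ ≤ ∑ _s : ι, |e m| * ε := by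
          refine Finset.sum_le_sum fun s _ => (le_abs_self _).trans ?_
          rw [abs_mul]
          exact mul_le_mul (hm s (Finset.mem_univ s)) (hW s) (abs_nonneg _) (abs_nonneg _)
      _ = Fintype.card ι * ε * |e m| := by simp; ring
  rw [le_div_iff₀ ht]
  rcases (abs_nonneg (e m)).eq_or_lt with h0 | h0
  · rw [← h0]; simp; positivity
  · nlinarith

/-- The deterministic error bound: a lower bound on the quadratic form of `Ω̄` and an upper bound
on the residual of the normal equations at a reference polynomial control the distance from
`η̂^*(x)` to the value of that polynomial at `0`. -/
theorem abs_etaStar_sub_le {d n : ℕ} {β : ℝ} (K : E d → ℝ) {h : ℝ} (hh : 0 < h) (hn : 1 < n)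
    (ω : Fin n → Z d) (x : E d) {t ε : ℝ} (ht : (Real.log n)⁻¹ < t)
    (hM : ∀ w, t * ∑ s, w s ^ 2 ≤ quadForm (omegaBar (floorLT β) K h ω x) w)
    {T : MultiIdx d (floorLT β) → ℝ} (hT0 : 0 ≤ T (zeroIdx d _)) (hT1 : T (zeroIdx d _) ≤ 1)
    (hW : ∀ s, |lpResidual K h ω x T s| ≤ ε) :
    |etaStar β K h ω x - T (zeroIdx d _)| ≤ Fintype.card (MultiIdx d (floorLT β)) * ε / t := by
  have hlog : 0 < Real.log n := Real.log_pos (by exact_mod_cast hn)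
  have ht0 : 0 < t := (inv_pos.2 hlog).trans ht
  have hpos : ∀ w, w ≠ 0 → 0 < quadForm (omegaBar (floorLT β) K h ω x) w :=
    fun w hw => quadForm_pos_of_lt ht0 hM hw
  have hlt : (Real.log n)⁻¹ < minEigenvalue (floorLT β) K h ω x :=
    ht.trans_le ((le_minEigenvalue_iff K h ω x t).2 hM)
  rw [etaStar, if_pos ⟨hn, hlt⟩]
  set S := (omegaBar (floorLT β) K h ω x)⁻¹.mulVec (lpRhs (floorLT β) K h ω x) with hS
  have hres := lpResidual_inv_mulVec K h ω x hpos
  rw [lpEstimator_eq K hh (by omega) ω x hpos hres, ← hS]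
  have hdiff : (omegaBar (floorLT β) K h ω x).mulVec (S - T) = lpResidual K h ω x T := by
    rw [Matrix.mulVec_sub, lpResidual_eq]
    rw [← hS, lpResidual_eq, sub_eq_zero] at hres
    rw [hres]
  refine le_trans ?_ (abs_le_of_mulVec_eq ht0 hM hdiff hW (zeroIdx d _))
  rw [Pi.sub_apply]
  generalize S (zeroIdx d (floorLT β)) = a at *
  generalize T (zeroIdx d (floorLT β)) = b at *
  have hb : max 0 (min 1 b) = b := by rw [min_eq_right hT1, max_eq_right hT0]
  conv_lhs => rw [← hb]
  refine (abs_max_sub_max_le_max _ _ _ _).trans ?_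
  rw [sub_self, abs_zero, max_eq_right (abs_nonneg _)]
  refine (abs_min_sub_min_le_max _ _ _ _).trans ?_
  rw [sub_self, abs_zero, max_eq_right (abs_nonneg _)]

/-! ### Measurability of the classifier -/

@[fun_prop]
theorem measurable_mono {d : ℕ} (s : Fin d → ℕ) : Measurable fun u : E d => mono u s :=
  (continuous_mono s).measurable

@[fun_prop]
theorem measurable_label : Measurable label := measurable_of_countable _

theorem measurable_polyEval {d l : ℕ} (T : MultiIdx d l → ℝ) :
    Measurable fun u : E d => polyEval T u := by
  unfold polyEval
  fun_prop

theorem measurable_omegaBar {d n : ℕ} (l : ℕ) {K : E d → ℝ} (hK : Measurable K) (h : ℝ)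
    (s t : MultiIdx d l) :
    Measurable fun p : (Fin n → Z d) × E d => omegaBar l K h p.1 p.2 s t := by
  unfold omegaBar
  fun_prop

theorem measurable_lpRhs {d n : ℕ} (l : ℕ) {K : E d → ℝ} (hK : Measurable K) (h : ℝ)
    (s : MultiIdx d l) :
    Measurable fun p : (Fin n → Z d) × E d => lpRhs l K h p.1 p.2 s := by
  unfold lpRhs
  fun_prop

theorem measurable_det {ι Ω : Type*} [Fintype ι] [DecidableEq ι] [MeasurableSpace Ω]
    {A : Ω → Matrix ι ι ℝ} (hA : ∀ s t, Measurable fun p => A p s t) :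
    Measurable fun p => (A p).det := by
  simp only [Matrix.det_apply]
  refine Finset.measurable_sum _ fun σ _ => ?_
  exact (Finset.measurable_prod _ fun i _ => hA _ _).const_smul _

theorem measurable_inv_apply {ι Ω : Type*} [Fintype ι] [DecidableEq ι] [MeasurableSpace Ω]
    {A : Ω → Matrix ι ι ℝ} (hA : ∀ s t, Measurable fun p => A p s t) (s t : ι) :
    Measurable fun p => (A p)⁻¹ s t := by
  simp only [Matrix.inv_def, Matrix.smul_apply, Ring.inverse_eq_inv', smul_eq_mul,
    Matrix.adjugate_apply]
  refine (measurable_det hA).inv.mul (measurable_det fun i j => ?_)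
  by_cases hi : i = t
  · subst hi
    simp
  · simpa [Matrix.updateRow_ne hi] using hA i j

theorem measurable_minEigenvalue {d n : ℕ} (l : ℕ) {K : E d → ℝ} (hK : Measurable K) (h : ℝ) :
    Measurable fun p : (Fin n → Z d) × E d => minEigenvalue l K h p.1 p.2 := by
  refine measurable_of_Ici fun t => ?_
  have hclosed : IsClosed {M : MultiIdx d l → MultiIdx d l → ℝ |
      ∀ w, t * ∑ s, w s ^ 2 ≤ quadForm M w} := by
    simp only [Set.ofPred_forall]
    refine isClosed_iInter fun w => isClosed_le continuous_const ?_
    unfold quadForm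
    fun_prop
  have hm : Measurable fun p : (Fin n → Z d) × E d =>
      (fun s t => omegaBar l K h p.1 p.2 s t : MultiIdx d l → MultiIdx d l → ℝ) :=
    measurable_pi_lambda _ fun s => measurable_pi_lambda _ fun t => measurable_omegaBar l hK h s t
  convert hm hclosed.measurableSet using 1
  ext p
  exact le_minEigenvalue_iff K h p.1 p.2 t

theorem measurable_etaStar {d n : ℕ} {β : ℝ} {K : E d → ℝ} (hK : Measurable K) {h : ℝ}
    (hh : 0 < h) : Measurable fun p : (Fin n → Z d) × E d => etaStar β K h p.1 p.2 := by
  classical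
  by_cases hn : 1 < n
  swap
  · simp [etaStar, hn]
  -- where the eigenvalue condition holds, the estimator is given by the normal equations
  have heq : (fun p : (Fin n → Z d) × E d => etaStar β K h p.1 p.2) = fun p =>
      if p ∈ {p : (Fin n → Z d) × E d | (Real.log n)⁻¹ < minEigenvalue (floorLT β) K h p.1 p.2} then
        max 0 (min 1 ((omegaBar (floorLT β) K h p.1 p.2)⁻¹.mulVec
          (lpRhs (floorLT β) K h p.1 p.2) (zeroIdx d _))) else 0 := by
    funext p
    simp only [etaStar, hn, true_and, Set.mem_ofPred_eq]
    split_ifs with hlt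
    · have hpos : ∀ w, w ≠ 0 → 0 < quadForm (omegaBar (floorLT β) K h p.1 p.2) w :=
        fun w hw => quadForm_pos_of_lt
          ((inv_pos.2 (Real.log_pos (by exact_mod_cast hn))).trans hlt)
          ((le_minEigenvalue_iff K h p.1 p.2 _).1 le_rfl) hw
      rw [lpEstimator_eq K hh (by omega) p.1 p.2 hpos (lpResidual_inv_mulVec K h p.1 p.2 hpos)]
    · rfl
  rw [heq]
  refine Measurable.ite (measurableSet_lt measurable_const (measurable_minEigenvalue _ hK h)) ?_
    measurable_const
  refine measurable_const.max (measurable_const.min ?_)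
  simp only [Matrix.mulVec, dotProduct]
  refine Finset.measurable_sum _ fun s _ => Measurable.mul ?_ (measurable_lpRhs _ hK h s)
  exact measurable_inv_apply (fun s t => measurable_omegaBar _ hK h s t) _ _

theorem measurable_plugIn {d : ℕ} {Ω : Type*} [MeasurableSpace Ω] {g : Ω → E d → ℝ}
    (hg : Measurable fun p : Ω × E d => g p.1 p.2) :
    Measurable fun p : Ω × E d => plugIn (g p.1) p.2 := by
  classical
  simp only [plugIn]
  exact Measurable.ite (measurableSet_le measurable_const hg) measurable_const measurable_const

theorem measurable_fStar {d n : ℕ} (hn : 1 ≤ n) {β : ℝ} {K : E d → ℝ} (hK : Measurable K) :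
    Measurable fun p : (Fin n → Z d) × E d => fStar n β K p.1 p.2 :=
  measurable_plugIn (measurable_etaStar hK (Real.rpow_pos_of_pos (by exact_mod_cast hn) _))

/-! ### A Bernstein-type inequality -/

/-- The moment generating function of a bounded variable, from `e^z ≤ 1 + z + z²` for
`|z| ≤ 1`. -/
theorem integral_exp_le {Ω : Type*} [MeasurableSpace Ω] {P : Measure Ω} [IsProbabilityMeasure P]
    {g : Ω → ℝ} (hg : AEStronglyMeasurable g P) {M v c : ℝ} (hM : ∀ᵐ z ∂P, |g z| ≤ M)
    (hv : ∫ z, g z ^ 2 ∂P ≤ v) (hc : |c| * M ≤ 1) :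
    ∫ z, Real.exp (c * g z) ∂P ≤ Real.exp (c * (∫ z, g z ∂P) + c ^ 2 * v) := by
  have hb : ∀ᵐ z ∂P, |c * g z| ≤ 1 := by
    filter_upwards [hM] with z hz
    rw [abs_mul]
    exact (mul_le_mul_of_nonneg_left hz (abs_nonneg c)).trans hc
  have hgi : Integrable g P := Integrable.of_bound hg M (by simpa using hM)
  have hg2 : Integrable (fun z => g z ^ 2) P := by
    refine Integrable.of_bound (hg.pow 2) (M ^ 2) ?_
    filter_upwards [hM] with z hz
    rw [Real.norm_eq_abs, abs_pow]
    exact pow_le_pow_left₀ (abs_nonneg _) hz 2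
  have hexp : Integrable (fun z => Real.exp (c * g z)) P := by
    refine Integrable.of_bound (Real.continuous_exp.comp_aestronglyMeasurable (hg.const_mul c))
      (Real.exp 1) ?_
    filter_upwards [hb] with z hz
    rw [Real.norm_eq_abs, Real.abs_exp]
    exact Real.exp_le_exp.2 ((le_abs_self _).trans hz)
  have hint : Integrable (fun z => 1 + c * g z + c ^ 2 * g z ^ 2) P :=
    ((integrable_const 1).add (hgi.const_mul c)).add (hg2.const_mul _)
  calc ∫ z, Real.exp (c * g z) ∂P ≤ ∫ z, (1 + c * g z + c ^ 2 * g z ^ 2) ∂P := by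
        refine integral_mono_ae hexp hint ?_
        filter_upwards [hb] with z hz
        have := (abs_le.1 (Real.abs_exp_sub_one_sub_id_le hz)).2
        nlinarith
    _ = 1 + c * (∫ z, g z ∂P) + c ^ 2 * ∫ z, g z ^ 2 ∂P := by
        have h1 : Integrable (fun z => 1 + c * g z) P := (integrable_const 1).add (hgi.const_mul c)
        rw [integral_add h1 (hg2.const_mul _),
          integral_add (integrable_const 1) (hgi.const_mul c), integral_const_mul,
          integral_const_mul]
        simp
    _ ≤ 1 + (c * (∫ z, g z ∂P) + c ^ 2 * v) := by nlinarith [sq_nonneg c]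
    _ ≤ _ := by linarith [Real.add_one_le_exp (c * (∫ z, g z ∂P) + c ^ 2 * v)]

/-- One-sided Chernoff bound for an i.i.d. sum. -/
theorem measureReal_sum_ge_le {Ω : Type*} [MeasurableSpace Ω] {P : Measure Ω}
    [IsProbabilityMeasure P] {g : Ω → ℝ} (hg : Measurable g) {M v c : ℝ}
    (hM : ∀ᵐ z ∂P, |g z| ≤ M) (hv : ∫ z, g z ^ 2 ∂P ≤ v) (hc0 : 0 ≤ c) (hc : c * M ≤ 1)
    (n : ℕ) (a : ℝ) :
    (Measure.pi fun _ : Fin n => P).real {ω | n * (∫ z, g z ∂P) + a ≤ ∑ i, g (ω i)} ≤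
      Real.exp (n * c ^ 2 * v - c * a) := by
  set μ := Measure.pi fun _ : Fin n => P
  have hmgf : mgf (fun ω : Fin n → Ω => ∑ i, g (ω i)) μ c ≤
      Real.exp (c * (∫ z, g z ∂P) + c ^ 2 * v) ^ n := by
    have : mgf (fun ω : Fin n → Ω => ∑ i, g (ω i)) μ c = (∫ z, Real.exp (c * g z) ∂P) ^ n := by
      simp only [mgf, Finset.mul_sum, Real.exp_sum]
      rw [integral_fintype_prod_eq_prod (fun _ z => Real.exp (c * g z))]
      simp
    rw [this]
    exact pow_le_pow_left₀ (integral_nonneg fun _ => (Real.exp_pos _).le)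
      (integral_exp_le hg.aestronglyMeasurable hM hv (by rwa [abs_of_nonneg hc0])) n
  have hint : Integrable (fun ω : Fin n → Ω => Real.exp (c * ∑ i, g (ω i))) μ := by
    have hb : ∀ᵐ ω ∂μ, ∀ i, |g (ω i)| ≤ M := by
      rw [ae_all_iff]
      exact fun i => (measurePreserving_eval (fun _ : Fin n => P) i).quasiMeasurePreserving.ae hM
    refine Integrable.of_bound (Measurable.aestronglyMeasurable (by fun_prop))
      (Real.exp (c * (n * M))) ?_
    filter_upwards [hb] with ω hω
    rw [Real.norm_eq_abs, Real.abs_exp, Real.exp_le_exp]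
    refine mul_le_mul_of_nonneg_left ?_ hc0
    calc ∑ i, g (ω i) ≤ ∑ _i : Fin n, M :=
          Finset.sum_le_sum fun i _ => (le_abs_self _).trans (hω i)
      _ = n * M := by simp
  refine (measure_ge_le_exp_mul_mgf _ hc0 hint).trans ?_
  refine (mul_le_mul_of_nonneg_left hmgf (Real.exp_pos _).le).trans ?_
  rw [← Real.exp_nat_mul, ← Real.exp_add]
  exact Real.exp_le_exp.2 (le_of_eq (by ring))

/-- Bernstein's inequality for normalised sums `(n q)⁻¹ ∑ g(Zᵢ)`, where `q` is the order of
magnitude of the variance of `g(Z)`. In the application `q = h^d`. -/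
theorem bernstein {Ω : Type*} [MeasurableSpace Ω] {P : Measure Ω}
    [IsProbabilityMeasure P] {g : Ω → ℝ} (hg : Measurable g) {M v q r ε : ℝ}
    (hM : ∀ᵐ z ∂P, |g z| ≤ M) (hq : 0 < q) (hv : ∫ z, g z ^ 2 ∂P ≤ v * q) (hr : 0 < r)
    (hrM : r * M ≤ 1) (hrv : 2 * r * v ≤ 1) (hε0 : 0 < ε) (hε1 : ε ≤ 1) {n : ℕ} (hn : 0 < n) :
    (Measure.pi fun _ : Fin n => P).real
      {ω | ε ≤ |1 / (n * q) * ∑ i, g (ω i) - 1 / q * ∫ z, g z ∂P|} ≤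
      2 * Real.exp (-(r / 2 * (n * q) * ε ^ 2)) := by
  have hM0 : 0 ≤ M := by
    obtain ⟨z, hz⟩ := hM.exists
    exact (abs_nonneg _).trans hz
  have hnq : 0 < n * q := by positivity
  have key : ∀ g : Ω → ℝ, Measurable g → (∀ᵐ z ∂P, |g z| ≤ M) → (∫ z, g z ^ 2 ∂P ≤ v * q) →
      (Measure.pi fun _ : Fin n => P).real
        {ω | n * (∫ z, g z ∂P) + n * q * ε ≤ ∑ i, g (ω i)} ≤
      Real.exp (-(r / 2 * (n * q) * ε ^ 2)) := by
    intro g hg hM hv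
    refine (measureReal_sum_ge_le hg hM hv (c := r * ε) (by positivity) ?_ n _).trans ?_
    · nlinarith [mul_nonneg hr.le hM0]
    · refine Real.exp_le_exp.2 ?_
      have : n * (r * ε) ^ 2 * (v * q) ≤ r / 2 * (n * q) * ε ^ 2 := by
        have h1 : 0 ≤ r * (n * q) * ε ^ 2 := by positivity
        nlinarith [mul_le_mul_of_nonneg_left hrv h1]
      linarith
  have h1 := key g hg hM hv
  have h2 := key (fun z => -g z) hg.neg (by simpa using hM) (by simpa using hv)
  rw [two_mul]
  refine le_trans ?_ (add_le_add h1 h2)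
  refine le_trans (measureReal_mono ?_) (measureReal_union_le _ _)
  intro ω hω
  simp only [Set.mem_ofPred_eq, Set.mem_union, integral_neg, Finset.sum_neg_distrib] at hω ⊢
  have h3 : 1 / (n * q) * ∑ i, g (ω i) - 1 / q * ∫ z, g z ∂P =
      (∑ i, g (ω i) - n * ∫ z, g z ∂P) / (n * q) := by
    field_simp
  rw [h3, abs_div, abs_of_pos hnq, le_div_iff₀ hnq] at hω
  rcases le_abs.1 hω with h | h
  · left; linarith
  · right; linarith

/-! ### A uniform lower bound for integrals of squared polynomials -/

open scoped Topology

/-- The zero set of a nonzero polynomial in several real variables is a null set. -/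
theorem volume_eval_eq_zero : ∀ (n : ℕ) (p : MvPolynomial (Fin n) ℝ), p ≠ 0 →
    volume {x : Fin n → ℝ | MvPolynomial.eval x p = 0} = 0 := by
  intro n
  induction n with
  | zero =>
    intro p hp
    have : {x : Fin 0 → ℝ | MvPolynomial.eval x p = 0} = ∅ := by
      refine Set.eq_empty_of_forall_notMem fun x hx => hp ?_
      refine MvPolynomial.funext fun y => ?_
      rw [Subsingleton.elim y x]
      simpa using hx
    rw [this, measure_empty]
  | succ n ih =>
    intro p hp
    set q := MvPolynomial.finSuccEquiv ℝ n p with hq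
    have hq0 : q ≠ 0 := by simpa [hq] using hp
    have hlead := ih q.leadingCoeff (Polynomial.leadingCoeff_ne_zero.2 hq0)
    have hmp := (volume_preserving_piFinSuccAbove (fun _ : Fin (n + 1) => ℝ) 0).symm
    have hmeas : MeasurableSet {x : Fin (n + 1) → ℝ | MvPolynomial.eval x p = 0} :=
      measurableSet_eq_fun (MvPolynomial.continuous_eval p).measurable measurable_const
    rw [← hmp.measure_preimage hmeas.nullMeasurableSet, Measure.volume_eq_prod,
      Measure.prod_apply_symm (hmp.measurable hmeas)]
    refine (lintegral_congr_ae ?_).trans lintegral_zero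
    filter_upwards [measure_eq_zero_iff_ae_notMem.1 hlead] with s hs
    have hmap : Polynomial.map (MvPolynomial.eval s) q ≠ 0 := by
      intro h0
      apply hs
      have := congrArg (fun r => Polynomial.coeff r q.natDegree) h0
      simpa using this
    refine Set.Finite.measure_zero
      ((Polynomial.finite_setOfPred_isRoot hmap).subset fun y hy => ?_) _
    simp only [Set.mem_preimage, Set.mem_ofPred_eq] at hy ⊢
    rw [Polynomial.IsRoot.def, hq, ← MvPolynomial.eval_eq_eval_mv_eval']
    simpa [MeasurableEquiv.piFinSuccAbove, Fin.insertNthEquiv, Fin.insertNth_zero'] using hy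

theorem volume_polyEval_eq_zero {d l : ℕ} {w : MultiIdx d l → ℝ} (hw : w ≠ 0) :
    volume {u : E d | polyEval w u = 0} = 0 := by
  classical
  set p : MvPolynomial (Fin d) ℝ :=
    ∑ s : MultiIdx d l, MvPolynomial.monomial (Finsupp.equivFunOnFinite.symm s.1) (w s) with hp
  have heval : ∀ u : E d, MvPolynomial.eval (WithLp.ofLp u) p = polyEval w u := by
    intro u
    simp [hp, polyEval, mono, MvPolynomial.eval_monomial, Finsupp.prod_fintype]
  have hp0 : p ≠ 0 := by
    obtain ⟨s, hs⟩ := Function.ne_iff.1 hw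
    intro h0
    have := congrArg (MvPolynomial.coeff (Finsupp.equivFunOnFinite.symm s.1)) h0
    rw [hp, MvPolynomial.coeff_sum] at this
    simp only [MvPolynomial.coeff_monomial, EmbeddingLike.apply_eq_iff_eq, MvPolynomial.coeff_zero,
      ← Subtype.ext_iff, Finset.sum_ite_eq', Finset.mem_univ, if_true] at this
    exact hs this
  have hmeas : MeasurableSet {x : Fin d → ℝ | MvPolynomial.eval x p = 0} :=
    measurableSet_eq_fun (MvPolynomial.continuous_eval p).measurable measurable_const
  have := (PiLp.volume_preserving_ofLp (Fin d)).measure_preimage hmeas.nullMeasurableSet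
  rw [volume_eval_eq_zero d p hp0] at this
  rw [← this]
  congr 1
  ext u
  simp [heval]

/-- Local form of the lower bound: near a fixed nonzero polynomial, the squared integrals over
all sets of measure at least `m` in a fixed ball stay away from `0`. -/
theorem exists_eventually_le_setIntegral_sq {d l : ℕ} (c : ℝ) {m : ℝ} (hm : 0 < m)
    {w : MultiIdx d l → ℝ} (hw : w ≠ 0) :
    ∃ ε : ℝ, 0 < ε ∧ ∀ᶠ w' in 𝓝 w, ∀ S : Set (E d), MeasurableSet S →
      S ⊆ Metric.closedBall 0 c → ENNReal.ofReal m ≤ volume S →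
      ε ≤ ∫ u in S, polyEval w' u ^ 2 := by
  -- a sublevel set of `|p_w|` with small volume in the ball
  set V : ℕ → Set (E d) := fun k => {u | |polyEval w u| ≤ 1 / (k + 1)} ∩ Metric.closedBall 0 c
    with hV
  have hVm : ∀ k, MeasurableSet (V k) := fun k =>
    (measurableSet_le (measurable_polyEval w).abs measurable_const).inter
      Metric.isClosed_closedBall.measurableSet
  have hVanti : Antitone V := by
    intro j k hjk
    refine Set.inter_subset_inter_left _ fun u hu => ?_
    exact le_trans (show |polyEval w u| ≤ _ from hu) (Nat.one_div_le_one_div hjk)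
  have hVlim : Tendsto (fun k => volume (V k)) atTop (𝓝 0) := by
    have h1 := tendsto_measure_iInter_atTop (μ := volume) (fun k => (hVm k).nullMeasurableSet)
      hVanti ⟨0, ne_top_of_le_ne_top (measure_closedBall_lt_top (x := (0 : E d)) (r := c)).ne
        (measure_mono Set.inter_subset_right)⟩
    have h2 : volume (⋂ k, V k) = 0 := by
      refine measure_mono_null (fun u hu => ?_) (volume_polyEval_eq_zero hw)
      rw [Set.mem_iInter] at hu
      have h3 : |polyEval w u| ≤ 0 :=
        ge_of_tendsto' (tendsto_one_div_add_atTop_nhds_zero_nat) fun k => (hu k).1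
      exact abs_eq_zero.1 (le_antisymm h3 (abs_nonneg _))
    rwa [h2] at h1
  obtain ⟨k, hk⟩ := (hVlim.eventually_lt_const
    (show (0 : ENNReal) < ENNReal.ofReal (m / 2) by simpa using half_pos hm)).exists
  set δ : ℝ := 1 / ((k : ℝ) + 1) with hδ
  have hδ0 : 0 < δ := by positivity
  refine ⟨(δ / 2) ^ 2 * (m / 2), by positivity, ?_⟩
  have hclose : ∀ᶠ w' in 𝓝 w, ∀ u ∈ Metric.closedBall (0 : E d) c,
      |polyEval w' u - polyEval w u| < δ / 2 := by
    refine (isCompact_closedBall (0 : E d) c).eventually_forall_of_forall_eventually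
      fun u _ => ?_
    have hcont : Continuous fun p : (MultiIdx d l → ℝ) × E d =>
        |polyEval p.1 p.2 - polyEval w p.2| := by
      have : Continuous fun p : (MultiIdx d l → ℝ) × E d => polyEval w p.2 :=
        continuous_polyEval.comp (continuous_const.prodMk continuous_snd)
      exact (continuous_polyEval.sub this).abs
    refine (hcont.tendsto (w, u)).eventually_lt_const ?_
    simpa using half_pos hδ0
  filter_upwards [hclose] with w' hw' S hS hSc hSm
  have hint : IntegrableOn (fun u => polyEval w' u ^ 2) S := by
    refine IntegrableOn.mono_set ?_ hSc
    refine ContinuousOn.integrableOn_compact (isCompact_closedBall _ _) (Continuous.continuousOn ?_)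
    exact (continuous_polyEval.comp (continuous_const.prodMk continuous_id)).pow 2
  have hfin : volume (S \ V k) ≠ ⊤ :=
    ne_top_of_le_ne_top (measure_closedBall_lt_top (x := (0 : E d)) (r := c)).ne
      (measure_mono (Set.sdiff_subset.trans hSc))
  have hvol : m / 2 ≤ volume.real (S \ V k) := by
    rw [Measure.real, ← ENNReal.ofReal_le_iff_le_toReal hfin]
    have h1 : volume S ≤ volume (V k) + volume (S \ V k) := by
      refine (measure_mono ?_).trans (measure_union_le _ _)
      rw [Set.union_sdiff_self]
      exact Set.subset_union_right
    have h2 : ENNReal.ofReal (m / 2) + ENNReal.ofReal (m / 2) ≤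
        ENNReal.ofReal (m / 2) + volume (S \ V k) := by
      rw [← ENNReal.ofReal_add (half_pos hm).le (half_pos hm).le, add_halves]
      exact hSm.trans (h1.trans (add_le_add_left hk.le _))
    exact (ENNReal.add_le_add_iff_left ENNReal.ofReal_ne_top).1 h2
  calc (δ / 2) ^ 2 * (m / 2) ≤ (δ / 2) ^ 2 * volume.real (S \ V k) := by gcongr
    _ = ∫ _u in S \ V k, (δ / 2) ^ 2 := by simp [mul_comm]
    _ ≤ ∫ u in S \ V k, polyEval w' u ^ 2 := by
        refine setIntegral_mono_on (integrableOn_const hfin)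
          (hint.mono_set Set.sdiff_subset) (hS.diff (hVm k)) fun u hu => ?_
        have h1 : δ < |polyEval w u| := by
          by_contra! h
          exact hu.2 ⟨h, hSc hu.1⟩
        have h2 := hw' u (hSc hu.1)
        have h3 : δ / 2 ≤ |polyEval w' u| := by
          have := abs_sub_abs_le_abs_sub (polyEval w u) (polyEval w' u)
          rw [abs_sub_comm] at this
          linarith
        rw [← sq_abs (polyEval w' u)]
        exact pow_le_pow_left₀ (by positivity) h3 2
    _ ≤ ∫ u in S, polyEval w' u ^ 2 :=
        setIntegral_mono_set hint (Eventually.of_forall fun _ => sq_nonneg _)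
          (Set.sdiff_subset.eventuallyLE)

/-- The squared integral of a polynomial over any subset of a ball with volume at least `m` is
bounded below by a multiple of the squared norm of its coefficients. -/
theorem exists_le_setIntegral_sq (d l : ℕ) (c : ℝ) {m : ℝ} (hm : 0 < m) :
    ∃ ε : ℝ, 0 < ε ∧ ∀ S : Set (E d), MeasurableSet S →
      S ⊆ Metric.closedBall 0 c → ENNReal.ofReal m ≤ volume S →
      ∀ w : MultiIdx d l → ℝ, ε * ∑ s, w s ^ 2 ≤ ∫ u in S, polyEval w u ^ 2 := by
  obtain ⟨ε, hε, H⟩ : ∃ ε : ℝ, 0 < ε ∧ ∀ w ∈ Metric.sphere (0 : MultiIdx d l → ℝ) 1,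
      ∀ S : Set (E d), MeasurableSet S → S ⊆ Metric.closedBall 0 c →
        ENNReal.ofReal m ≤ volume S → ε ≤ ∫ u in S, polyEval w u ^ 2 := by
    refine (isCompact_sphere (0 : MultiIdx d l → ℝ) 1).induction_on
      (p := fun W => ∃ ε : ℝ, 0 < ε ∧ ∀ w ∈ W,
        ∀ S : Set (E d), MeasurableSet S → S ⊆ Metric.closedBall 0 c →
          ENNReal.ofReal m ≤ volume S → ε ≤ ∫ u in S, polyEval w u ^ 2) ?_ ?_ ?_ ?_
    · exact ⟨1, one_pos, by simp⟩
    · rintro W W' hWW ⟨ε, hε, H⟩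
      exact ⟨ε, hε, fun w hw => H w (hWW hw)⟩
    · rintro W W' ⟨ε, hε, H⟩ ⟨ε', hε', H'⟩
      refine ⟨min ε ε', lt_min hε hε', ?_⟩
      rintro w (hw | hw) S h1 h2 h3
      · exact (min_le_left _ _).trans (H w hw S h1 h2 h3)
      · exact (min_le_right _ _).trans (H' w hw S h1 h2 h3)
    · intro w hw
      have hw0 : w ≠ 0 := by
        rintro rfl
        simp at hw
      obtain ⟨ε, hε, H⟩ := exists_eventually_le_setIntegral_sq c hm hw0
      exact ⟨_, mem_nhdsWithin_of_mem_nhds H, ε, hε, fun w' hw' => hw'⟩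
  have hcard : (0 : ℝ) < Fintype.card (MultiIdx d l) := by exact_mod_cast Fintype.card_pos
  refine ⟨ε / Fintype.card (MultiIdx d l), by positivity, fun S h1 h2 h3 w => ?_⟩
  rcases eq_or_ne w 0 with rfl | hw
  · simp only [Pi.zero_apply, ne_eq, OfNat.ofNat_ne_zero, not_false_eq_true, zero_pow,
      Finset.sum_const_zero, mul_zero]
    exact integral_nonneg fun _ => sq_nonneg _
  have hn : 0 < ‖w‖ := norm_pos_iff.2 hw
  have hs := H (‖w‖⁻¹ • w) (by simp [norm_smul, hn.ne']) S h1 h2 h3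
  have hsc : ∀ u, polyEval (‖w‖⁻¹ • w) u ^ 2 = (‖w‖⁻¹) ^ 2 * polyEval w u ^ 2 := by
    intro u
    simp only [polyEval, Pi.smul_apply, smul_eq_mul, mul_assoc, ← Finset.mul_sum, mul_pow]
  simp only [hsc] at hs
  rw [integral_const_mul, inv_pow, inv_mul_eq_div, le_div_iff₀ (by positivity)] at hs
  have hsum : ∑ s, w s ^ 2 ≤ Fintype.card (MultiIdx d l) * ‖w‖ ^ 2 := by
    calc ∑ s, w s ^ 2 ≤ ∑ _s : MultiIdx d l, ‖w‖ ^ 2 := by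
          refine Finset.sum_le_sum fun s _ => ?_
          rw [← sq_abs]
          exact pow_le_pow_left₀ (abs_nonneg _) (norm_le_pi_norm w s) 2
      _ = _ := by simp
  calc ε / Fintype.card (MultiIdx d l) * ∑ s, w s ^ 2
      ≤ ε / Fintype.card (MultiIdx d l) * (Fintype.card (MultiIdx d l) * ‖w‖ ^ 2) := by gcongr
    _ = ε * ‖w‖ ^ 2 := by field_simp
    _ ≤ _ := hs

/-! ### The law of the rescaled design point -/

/-- The rescaling `y ↦ (y - x)/h` around the point `x`. -/
def rescale {d : ℕ} (x : E d) (h : ℝ) (y : E d) : E d := h⁻¹ • (y - x)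

@[fun_prop]
theorem measurable_rescale {d : ℕ} (x : E d) (h : ℝ) : Measurable (rescale x h) := by
  unfold rescale
  fun_prop

theorem map_rescale_volume {d : ℕ} (x : E d) {h : ℝ} (hh : 0 < h) :
    (volume : Measure (E d)).map (rescale x h) = ENNReal.ofReal (h ^ d) • volume := by
  have h1 : rescale x h = (fun u => h⁻¹ • u) ∘ fun y => y - x := rfl
  rw [h1, ← Measure.map_map (measurable_const_smul _) (measurable_sub_const x),
    (measurePreserving_sub_right volume x).map_eq,
    Measure.map_addHaar_smul _ (inv_ne_zero hh.ne')]
  simp [abs_of_pos hh]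

theorem map_rescale_le {d : ℕ} {PX : Measure (E d)} {A : Set (E d)} {μ : E d → ℝ} {μmax : ℝ}
    (hμmax : 0 ≤ μmax) (hA : ∀ x ∈ A, μ x ≤ μmax) (hA0 : ∀ x ∉ A, μ x = 0)
    (hPX : PX = volume.withDensity fun x => ENNReal.ofReal (μ x)) (x : E d) {h : ℝ} (hh : 0 < h) :
    PX.map (rescale x h) ≤ ENNReal.ofReal (μmax * h ^ d) • volume := by
  have h1 : PX ≤ ENNReal.ofReal μmax • volume := by
    rw [hPX, ← withDensity_const]
    refine withDensity_mono (Eventually.of_forall fun y => ENNReal.ofReal_le_ofReal ?_)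
    by_cases hy : y ∈ A
    · exact hA y hy
    · rw [hA0 y hy]; exact hμmax
  refine (Measure.map_mono h1 (measurable_rescale x h)).trans (le_of_eq ?_)
  rw [Measure.map_smul, map_rescale_volume x hh, smul_smul, ENNReal.ofReal_mul hμmax]

/-- At a point of the regular support, the law of the rescaled design dominates a multiple of
Lebesgue measure on a subset of the ball that has a fixed proportion of its volume. -/
theorem exists_restrict_le_map_rescale {d : ℕ} {PX : Measure (E d)} {A : Set (E d)} {μ : E d → ℝ}
    {μmin c₀ r₀ : ℝ} (hAc : IsCompact A) (hAr : IsRegularSet c₀ r₀ A) (hμmin : 0 ≤ μmin)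
    (hA : ∀ x ∈ A, μmin ≤ μ x)
    (hPX : PX = volume.withDensity fun x => ENNReal.ofReal (μ x)) {x : E d} (hx : x ∈ A) {h c : ℝ}
    (hh : 0 < h) (hc : 0 < c) (hr : h * c ≤ r₀) :
    ∃ S : Set (E d), MeasurableSet S ∧ S ⊆ Metric.closedBall 0 c ∧
      ENNReal.ofReal c₀ * volume (Metric.closedBall (0 : E d) c) ≤ volume S ∧
      ENNReal.ofReal (μmin * h ^ d) • volume.restrict S ≤ PX.map (rescale x h) := by
  set S : Set (E d) := (fun u => x + h • u) ⁻¹' A with hS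
  have hinv : ∀ y, x + h • rescale x h y = y := fun y => by
    rw [rescale, smul_inv_smul₀ hh.ne', add_sub_cancel]
  have hSm : MeasurableSet S := by
    have : Measurable fun u : E d => x + h • u := by fun_prop
    exact this hAc.isClosed.measurableSet
  have hpre : rescale x h ⁻¹' S = A := by
    ext y
    simp only [hS, Set.mem_preimage, hinv]
  have hball : rescale x h ⁻¹' Metric.closedBall 0 c = Metric.closedBall x (h * c) := by
    ext y
    simp only [Set.mem_preimage, Metric.mem_closedBall, dist_eq_norm, rescale, sub_zero,
      norm_smul, norm_inv, Real.norm_eq_abs, abs_of_pos hh]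
    rw [inv_mul_le_iff₀ hh]
  have hq0 : ENNReal.ofReal (h ^ d) ≠ 0 := by simpa using pow_pos hh d
  refine ⟨S ∩ Metric.closedBall 0 c, hSm.inter Metric.isClosed_closedBall.measurableSet,
    Set.inter_subset_right, ?_, ?_⟩
  · have h1 := hAr.2 (h * c) (by positivity) hr x hx
    have h2 : ∀ T : Set (E d), MeasurableSet T →
        volume (rescale x h ⁻¹' T) = ENNReal.ofReal (h ^ d) * volume T := by
      intro T hT
      rw [← Measure.map_apply (measurable_rescale x h) hT, map_rescale_volume x hh]
      rfl
    rw [← hball, ← hpre, ← Set.preimage_inter, h2 _ Metric.isClosed_closedBall.measurableSet,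
      h2 _ (hSm.inter Metric.isClosed_closedBall.measurableSet), mul_left_comm] at h1
    exact (ENNReal.mul_le_mul_iff_right hq0 ENNReal.ofReal_ne_top).1 h1
  · have h1 : ENNReal.ofReal μmin • volume.restrict A ≤ PX := by
      rw [hPX, ← withDensity_const,
        ← withDensity_indicator hAc.isClosed.measurableSet]
      refine withDensity_mono (Eventually.of_forall fun y => ?_)
      by_cases hy : y ∈ A
      · simpa [hy] using ENNReal.ofReal_le_ofReal (hA y hy)
      · simp [hy]
    refine le_trans ?_ (Measure.map_mono h1 (measurable_rescale x h))
    rw [Measure.map_smul, ← hpre, ← Measure.restrict_map (measurable_rescale x h) hSm,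
      map_rescale_volume x hh, Measure.restrict_smul, smul_smul, ENNReal.ofReal_mul hμmin]
    gcongr
    exact Set.inter_subset_left

theorem ae_fst_mem {d : ℕ} {PX : Measure (E d)} {A : Set (E d)} {μ : E d → ℝ}
    (hAc : IsCompact A) (hA0 : ∀ x ∉ A, μ x = 0)
    (hPX : PX = volume.withDensity fun x => ENNReal.ofReal (μ x)) : ∀ᵐ x ∂PX, x ∈ A := by
  rw [ae_iff, hPX]
  change volume.withDensity (fun x => ENNReal.ofReal (μ x)) Aᶜ = 0
  rw [withDensity_apply _ hAc.isClosed.measurableSet.compl,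
    setLIntegral_congr_fun hAc.isClosed.measurableSet.compl
      (fun x hx => show ENNReal.ofReal (μ x) = 0 by rw [hA0 x hx]; simp)]
  simp

section Moments

variable {d : ℕ} {P : Measure (Z d)} {x : E d} {h b : ℝ}

theorem integrable_comp_rescale
    (hν : P.fst.map (rescale x h) ≤ ENNReal.ofReal b • volume) {φ : E d → ℝ}
    (hφ : Integrable φ) : Integrable (fun z => φ (rescale x h z.1)) P := by
  have h1 : Integrable φ (P.fst.map (rescale x h)) :=
    (hφ.smul_measure ENNReal.ofReal_ne_top).mono_measure hν
  have h2 := h1.comp_measurable (measurable_rescale x h)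
  exact h2.comp_measurable measurable_fst

theorem integral_comp_rescale {φ : E d → ℝ} (hφm : Measurable φ) :
    ∫ z, φ (rescale x h z.1) ∂P = ∫ u, φ u ∂(P.fst.map (rescale x h)) := by
  rw [integral_map (measurable_rescale x h).aemeasurable hφm.aestronglyMeasurable, Measure.fst,
    integral_map measurable_fst.aemeasurable
      (hφm.comp (measurable_rescale x h)).aestronglyMeasurable (f := fun y => φ (rescale x h y))]

theorem integral_comp_rescale_le (hb : 0 ≤ b)
    (hν : P.fst.map (rescale x h) ≤ ENNReal.ofReal b • volume) {φ : E d → ℝ}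
    (hφ : Integrable φ) (hφm : Measurable φ) (hφ0 : ∀ u, 0 ≤ φ u) :
    ∫ z, φ (rescale x h z.1) ∂P ≤ b * ∫ u, φ u := by
  rw [integral_comp_rescale hφm]
  refine (integral_mono_measure hν (Eventually.of_forall hφ0)
    (hφ.smul_measure ENNReal.ofReal_ne_top)).trans (le_of_eq ?_)
  rw [integral_smul_measure, ENNReal.toReal_ofReal hb, smul_eq_mul]

end Moments

/-! ### Concentration of kernel averages -/

theorem rpow_le_one_add_rpow {r p q : ℝ} (hr : 0 ≤ r) (hp : 0 ≤ p) (hpq : p ≤ q) :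
    r ^ p ≤ 1 + r ^ q := by
  rcases le_total r 1 with h | h
  · exact (Real.rpow_le_one hr h hp).trans (by linarith [Real.rpow_nonneg hr q])
  · linarith [Real.rpow_le_rpow_of_exponent_le h hpq]

/-- The kernel averages `(n h^d)⁻¹ ∑ g(Zᵢ)` of functions `g` dominated by a multiple of
`(1 + |u|^{2β}) K(u)`, `u = (X - x)/h`, concentrate at scale `(n h^d)^{-1/2}`, with a constant
depending only on the multiple, on `K` and on the upper bound for the density. -/
theorem exists_concentration {d : ℕ} {β : ℝ} {K : E d → ℝ} (hK : IsKernel β K) {a μmax : ℝ}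
    (ha : 0 ≤ a) (hμmax : 0 ≤ μmax) :
    ∃ r : ℝ, 0 < r ∧ ∀ (P : Measure (Z d)) [IsProbabilityMeasure P] (x : E d) (h : ℝ), 0 < h →
      P.fst.map (rescale x h) ≤ ENNReal.ofReal (μmax * h ^ d) • volume →
      ∀ g : Z d → ℝ, Measurable g →
      (∀ᵐ z ∂P, |g z| ≤ a * ((1 + ‖rescale x h z.1‖ ^ (2 * β)) * K (rescale x h z.1))) →
      ∀ ε : ℝ, 0 < ε → ε ≤ 1 → ∀ n : ℕ, 0 < n →
      (Measure.pi fun _ : Fin n => P).real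
        {ω | ε ≤ |1 / (n * h ^ d) * ∑ i, g (ω i) - 1 / h ^ d * ∫ z, g z ∂P|} ≤
        2 * Real.exp (-(r * (n * h ^ d) * ε ^ 2)) := by
  obtain ⟨M, hM⟩ := hK.bounded
  have hM0 : 0 ≤ M := le_trans (mul_nonneg (by positivity) (hK.nonneg 0)) (hM 0)
  set φ : E d → ℝ := fun u => 2 * a ^ 2 * ((1 + ‖u‖ ^ (4 * β)) * K u ^ 2) with hφ
  have hφi : Integrable φ := hK.integrable_sq.const_mul _
  have hφ0 : ∀ u, 0 ≤ φ u := fun u => by positivity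
  have hφm : Measurable φ := by
    have := hK.measurable
    fun_prop
  set I := ∫ u, φ u with hI
  have hI0 : 0 ≤ I := integral_nonneg hφ0
  have hD : 0 < 1 + a * M + 2 * (μmax * I) := by positivity
  set r := 1 / (1 + a * M + 2 * (μmax * I)) with hr
  refine ⟨r / 2, by positivity, ?_⟩
  intro P _ x h hh hν g hg hga ε hε0 hε1 n hn
  refine bernstein hg (M := a * M) (v := μmax * I) ?_ (by positivity) ?_ (by positivity) ?_ ?_
    hε0 hε1 hn
  · filter_upwards [hga] with z hz
    exact hz.trans (mul_le_mul_of_nonneg_left (hM _) ha)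
  · calc ∫ z, g z ^ 2 ∂P ≤ ∫ z, φ (rescale x h z.1) ∂P := by
          refine integral_mono_of_nonneg (Eventually.of_forall fun _ => sq_nonneg _)
            (integrable_comp_rescale hν hφi) ?_
          filter_upwards [hga] with z hz
          have h1 : g z ^ 2 ≤
              (a * ((1 + ‖rescale x h z.1‖ ^ (2 * β)) * K (rescale x h z.1))) ^ 2 := by
            rw [← sq_abs]
            exact pow_le_pow_left₀ (abs_nonneg _) hz 2
          refine h1.trans ?_
          have h2 : ‖rescale x h z.1‖ ^ (4 * β) = (‖rescale x h z.1‖ ^ (2 * β)) ^ 2 := by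
            rw [← Real.rpow_natCast, ← Real.rpow_mul (norm_nonneg _)]
            norm_num
            ring_nf
          simp only [hφ, h2]
          generalize ‖rescale x h z.1‖ ^ (2 * β) = y
          have h3 : 0 ≤ a ^ 2 * K (rescale x h z.1) ^ 2 := by positivity
          nlinarith [mul_nonneg h3 (sq_nonneg (1 - y))]
      _ ≤ μmax * h ^ d * I := integral_comp_rescale_le (by positivity) hν hφi hφm hφ0
      _ = μmax * I * h ^ d := by ring
  · rw [hr, div_mul_eq_mul_div, div_le_one hD, one_mul]
    nlinarith [mul_nonneg hμmax hI0]
  · rw [hr, mul_one_div, div_mul_eq_mul_div, div_le_one hD]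
    nlinarith [mul_nonneg ha hM0]

/-! ### Integration against the regression function -/

theorem regressionFun_mem {d : ℕ} (P : Measure (Z d)) [IsFiniteMeasure P] (x : E d) :
    0 ≤ regressionFun P x ∧ regressionFun P x ≤ 1 :=
  ⟨measureReal_nonneg, measureReal_le_one⟩

theorem measurable_regressionFun {d : ℕ} (P : Measure (Z d)) [IsFiniteMeasure P] :
    Measurable (regressionFun P) :=
  (Kernel.measurable_coe P.condKernel (measurableSet_singleton 1)).ennreal_toReal

/-- Integration over the label: `Y` equals `1` with conditional probability `η(X)`. -/
theorem integral_eq_integral_fst {d : ℕ} {P : Measure (Z d)} [IsFiniteMeasure P] {η : E d → ℝ}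
    (hη : IsRegressionFun P η) {f : Z d → ℝ} (hf : Integrable f P) :
    ∫ z, f z ∂P = ∫ x, (f (x, 0) * (1 - η x) + f (x, 1) * η x) ∂P.fst := by
  rw [← Measure.integral_condKernel hf]
  refine integral_congr_ae ?_
  filter_upwards [hη] with x hx
  rw [integral_fintype Integrable.of_finite, Fin.sum_univ_two, hx, regressionFun]
  have h1 : (P.condKernel x).real {0} = 1 - (P.condKernel x).real {1} := by
    have : ({0} : Set (Fin 2)) = {1}ᶜ := by
      ext i
      fin_cases i <;> simp
    rw [this, probReal_compl_eq_one_sub (measurableSet_singleton 1)]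
  rw [h1]
  simp only [smul_eq_mul]
  ring

/-! ### Taylor polynomials in the rescaled variable -/

theorem floorLT_lt {β : ℝ} (hβ : 0 < β) : (floorLT β : ℝ) < β := by
  have h : 0 < ⌈β⌉₊ := Nat.ceil_pos.2 hβ
  exact Nat.lt_ceil.1 (by unfold floorLT; omega)

/-- The coefficients of `u ↦ g_x(x + h u)`, where `g_x` is the Taylor polynomial at `x`. -/
def taylorCoeff {d : ℕ} (l : ℕ) (g : E d → ℝ) (x : E d) (h : ℝ) (s : MultiIdx d l) : ℝ :=
  h ^ (∑ i, s.1 i) * (multiD s.1 g x / ∏ i, (Nat.factorial (s.1 i) : ℝ))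

theorem polyEval_taylorCoeff {d : ℕ} (l : ℕ) (g : E d → ℝ) (x : E d) {h : ℝ} (hh : 0 < h)
    (y : E d) : polyEval (taylorCoeff l g x h) (rescale x h y) = taylorPoly l g x y := by
  have h1 : y - x = h • rescale x h y := by rw [rescale, smul_inv_smul₀ hh.ne']
  rw [taylorPoly, h1, polyEval]
  refine Finset.sum_congr rfl fun s _ => ?_
  rw [mono_smul, taylorCoeff]
  ring

theorem taylorCoeff_zeroIdx {d : ℕ} (l : ℕ) (g : E d → ℝ) (x : E d) (h : ℝ) :
    taylorCoeff l g x h (zeroIdx d l) = g x := by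
  have h1 : ∀ L : List (Fin d),
      L.foldr (fun i φ => (partialD i)^[(0 : Fin d → ℕ) i] φ) g = g := by
    intro L
    induction L with
    | nil => rfl
    | cons i L _ => simp
  simp [taylorCoeff, zeroIdx, multiD]

theorem abs_sub_polyEval_taylorCoeff_le {d : ℕ} {β L : ℝ} {g : E d → ℝ}
    (hg : g ∈ holderClass d β L) (x : E d) {h : ℝ} (hh : 0 < h) (y : E d) :
    |g y - polyEval (taylorCoeff (floorLT β) g x h) (rescale x h y)| ≤
      L * h ^ β * ‖rescale x h y‖ ^ β := by
  rw [polyEval_taylorCoeff _ _ _ hh]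
  refine (hg.2 x y).trans (le_of_eq ?_)
  have h1 : ‖x - y‖ = h * ‖rescale x h y‖ := by
    rw [norm_sub_rev, rescale, norm_smul, norm_inv, Real.norm_eq_abs, abs_of_pos hh,
      mul_inv_cancel_left₀ hh.ne']
  rw [h1, Real.mul_rpow hh.le (norm_nonneg _), mul_assoc]

/-! ### Bounds for the summands of `Ω̄` and of the residual -/

theorem abs_mono_le_rpow {d : ℕ} (u : E d) (s : Fin d → ℕ) :
    |mono u s| ≤ ‖u‖ ^ ((∑ i, s i : ℕ) : ℝ) := by
  rw [Real.rpow_natCast]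
  exact abs_mono_le u s

theorem multiIdx_le {d : ℕ} {β : ℝ} (s : MultiIdx d (floorLT β)) :
    ((∑ i, s.1 i : ℕ) : ℝ) ≤ floorLT β := by exact_mod_cast s.2

theorem abs_gram_summand_le {d : ℕ} {β : ℝ} (hβ : 0 < β) {K : E d → ℝ} (hK : ∀ u, 0 ≤ K u)
    (s t : MultiIdx d (floorLT β)) (u : E d) :
    |mono u (s.1 + t.1) * K u| ≤ 1 * ((1 + ‖u‖ ^ (2 * β)) * K u) := by
  rw [abs_mul, abs_of_nonneg (hK u), one_mul]
  refine mul_le_mul_of_nonneg_right ((abs_mono_le_rpow _ _).trans ?_) (hK u)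
  refine rpow_le_one_add_rpow (norm_nonneg _) (Nat.cast_nonneg _) ?_
  have h1 := multiIdx_le s
  have h2 := multiIdx_le t
  have h3 := floorLT_lt hβ
  simp only [Pi.add_apply, Finset.sum_add_distrib, Nat.cast_add]
  linarith

theorem abs_residual_summand_le {d : ℕ} {β L : ℝ} (hβ : 0 < β) (hL : 0 ≤ L) {K : E d → ℝ}
    (hK : ∀ u, 0 ≤ K u) (s : MultiIdx d (floorLT β)) (u : E d) {y e p : ℝ} (hy : |y - e| ≤ 1)
    (hp : |e - p| ≤ L * ‖u‖ ^ β) :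
    |(y - p) * mono u s.1 * K u| ≤ (1 + L) * ((1 + ‖u‖ ^ (2 * β)) * K u) := by
  have h1 : |y - p| ≤ 1 + L * ‖u‖ ^ β := by
    have : y - p = (y - e) + (e - p) := by ring
    rw [this]
    exact (abs_add_le _ _).trans (add_le_add hy hp)
  have hs := multiIdx_le s
  have hl := floorLT_lt hβ
  have hu := norm_nonneg u
  have h2 : ‖u‖ ^ ((∑ i, s.1 i : ℕ) : ℝ) ≤ 1 + ‖u‖ ^ (2 * β) :=
    rpow_le_one_add_rpow hu (Nat.cast_nonneg _) (by linarith)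
  have h3 : ‖u‖ ^ β * ‖u‖ ^ ((∑ i, s.1 i : ℕ) : ℝ) ≤ 1 + ‖u‖ ^ (2 * β) := by
    rw [← Real.rpow_add_of_nonneg hu hβ.le (Nat.cast_nonneg _)]
    exact rpow_le_one_add_rpow hu (by positivity) (by linarith)
  rw [abs_mul, abs_mul, abs_of_nonneg (hK u), ← mul_assoc]
  refine mul_le_mul_of_nonneg_right ?_ (hK u)
  calc |y - p| * |mono u s.1| ≤ (1 + L * ‖u‖ ^ β) * ‖u‖ ^ ((∑ i, s.1 i : ℕ) : ℝ) :=
        mul_le_mul h1 (abs_mono_le_rpow _ _) (abs_nonneg _) (by positivity)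
    _ = ‖u‖ ^ ((∑ i, s.1 i : ℕ) : ℝ) + L * (‖u‖ ^ β * ‖u‖ ^ ((∑ i, s.1 i : ℕ) : ℝ)) := by ring
    _ ≤ (1 + ‖u‖ ^ (2 * β)) + L * (1 + ‖u‖ ^ (2 * β)) := by gcongr
    _ = _ := by ring

theorem abs_label_sub_le {y : Fin 2} {e : ℝ} (h0 : 0 ≤ e) (h1 : e ≤ 1) : |label y - e| ≤ 1 := by
  rw [abs_le]
  fin_cases y <;> simp [label] <;> constructor <;> linarith

/-- The bias: the mean of the residual of the normal equations at the Taylor polynomial is of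
order `h^β`. -/
theorem abs_mean_residual_le {d : ℕ} {β L : ℝ} (hβ : 0 < β) (hL : 0 ≤ L) {K : E d → ℝ}
    (hK : IsKernel β K) {P : Measure (Z d)} [IsProbabilityMeasure P] {η : E d → ℝ}
    (hη : IsRegressionFun P η) {x : E d} {h μmax : ℝ} (hh : 0 < h)
    (hh1 : h ≤ 1) (hμmax : 0 ≤ μmax)
    (hν : P.fst.map (rescale x h) ≤ ENNReal.ofReal (μmax * h ^ d) • volume)
    {T : MultiIdx d (floorLT β) → ℝ}
    (hT : ∀ y, |η y - polyEval T (rescale x h y)| ≤ L * h ^ β * ‖rescale x h y‖ ^ β)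
    (s : MultiIdx d (floorLT β)) :
    |1 / h ^ d * ∫ z, (label z.2 - polyEval T (rescale x h z.1)) * mono (rescale x h z.1) s.1 *
        K (rescale x h z.1) ∂P| ≤
      L * μmax * (∫ u, (1 + ‖u‖ ^ (β + floorLT β)) * K u) * h ^ β := by
  have hKm := hK.measurable
  have hpm := measurable_polyEval T
  have hη01 : ∀ᵐ y ∂P.fst, 0 ≤ η y ∧ η y ≤ 1 := by
    filter_upwards [hη] with y hy
    rw [hy]
    exact regressionFun_mem P y
  have hη01' : ∀ᵐ z ∂P, 0 ≤ η z.1 ∧ η z.1 ≤ 1 := ae_of_ae_map measurable_fst.aemeasurable hη01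
  have hhβ : h ^ β ≤ 1 := Real.rpow_le_one hh.le hh1 hβ.le
  have hhβ0 : 0 ≤ h ^ β := Real.rpow_nonneg hh.le _
  have hT' : ∀ y, |η y - polyEval T (rescale x h y)| ≤ L * ‖rescale x h y‖ ^ β := fun y =>
    (hT y).trans (mul_le_mul_of_nonneg_right (mul_le_of_le_one_right hL hhβ) (by positivity))
  obtain ⟨M, hM⟩ := hK.bounded
  have hint : Integrable (fun z : Z d => (label z.2 - polyEval T (rescale x h z.1)) *
      mono (rescale x h z.1) s.1 * K (rescale x h z.1)) P := by
    refine Integrable.of_bound (Measurable.aestronglyMeasurable (by fun_prop)) ((1 + L) * M) ?_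
    filter_upwards [hη01'] with z hz
    exact (abs_residual_summand_le hβ hL hK.nonneg s _ (abs_label_sub_le hz.1 hz.2)
      (hT' z.1)).trans (mul_le_mul_of_nonneg_left (hM _) (by positivity))
  set φ : E d → ℝ := fun u => (1 + ‖u‖ ^ (β + floorLT β)) * K u with hφ
  have hφi : Integrable φ := by
    have := hK.integrable.add hK.moment
    refine this.congr (Eventually.of_forall fun u => ?_)
    simp only [hφ, Pi.add_apply]
    ring
  have hφm : Measurable φ := by fun_prop
  have hφ0 : ∀ u, 0 ≤ φ u := fun u => mul_nonneg (by positivity) (hK.nonneg u)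
  have hmoment : ∫ y, φ (rescale x h y) ∂P.fst ≤ μmax * h ^ d * ∫ u, φ u := by
    have := integral_comp_rescale_le (by positivity) hν hφi hφm hφ0
    rwa [Measure.fst, integral_map measurable_fst.aemeasurable
      (hφm.comp (measurable_rescale x h)).aestronglyMeasurable (f := fun y => φ (rescale x h y))]
  have hφiν : Integrable (fun y => φ (rescale x h y)) P.fst :=
    ((hφi.smul_measure ENNReal.ofReal_ne_top).mono_measure hν).comp_measurable
      (measurable_rescale x h)
  rw [integral_eq_integral_fst hη hint]
  have hbound : |∫ y, ((label 0 - polyEval T (rescale x h y)) * mono (rescale x h y) s.1 *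
      K (rescale x h y) * (1 - η y) + (label 1 - polyEval T (rescale x h y)) *
      mono (rescale x h y) s.1 * K (rescale x h y) * η y) ∂P.fst| ≤
      L * h ^ β * ∫ y, φ (rescale x h y) ∂P.fst := by
    rw [← integral_const_mul, ← Real.norm_eq_abs]
    refine norm_integral_le_of_norm_le (hφiν.const_mul _) (Eventually.of_forall fun y => ?_)
    have h1 : (label 0 - polyEval T (rescale x h y)) * mono (rescale x h y) s.1 *
        K (rescale x h y) * (1 - η y) + (label 1 - polyEval T (rescale x h y)) *
        mono (rescale x h y) s.1 * K (rescale x h y) * η y =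
        (η y - polyEval T (rescale x h y)) * mono (rescale x h y) s.1 * K (rescale x h y) := by
      simp [label]
      ring
    rw [h1, Real.norm_eq_abs, abs_mul, abs_mul, abs_of_nonneg (hK.nonneg _)]
    simp only [hφ]
    rw [← mul_assoc]
    refine mul_le_mul_of_nonneg_right ?_ (hK.nonneg _)
    have hu := norm_nonneg (rescale x h y)
    have h3 : ‖rescale x h y‖ ^ β * ‖rescale x h y‖ ^ ((∑ i, s.1 i : ℕ) : ℝ) ≤
        1 + ‖rescale x h y‖ ^ (β + floorLT β) := by
      rw [← Real.rpow_add_of_nonneg hu hβ.le (Nat.cast_nonneg _)]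
      exact rpow_le_one_add_rpow hu (by positivity) (by linarith [multiIdx_le s])
    calc |η y - polyEval T (rescale x h y)| * |mono (rescale x h y) s.1|
        ≤ (L * h ^ β * ‖rescale x h y‖ ^ β) * ‖rescale x h y‖ ^ ((∑ i, s.1 i : ℕ) : ℝ) :=
          mul_le_mul (hT y) (abs_mono_le_rpow _ _) (abs_nonneg _) (by positivity)
      _ = L * h ^ β * (‖rescale x h y‖ ^ β * ‖rescale x h y‖ ^ ((∑ i, s.1 i : ℕ) : ℝ)) := by ring
      _ ≤ _ := by gcongr
  have hhd : 0 < h ^ d := pow_pos hh d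
  rw [abs_mul, abs_of_pos (by positivity)]
  calc 1 / h ^ d * _ ≤ 1 / h ^ d * (L * h ^ β * (μmax * h ^ d * ∫ u, φ u)) := by
        refine mul_le_mul_of_nonneg_left (hbound.trans ?_) (by positivity)
        gcongr
    _ = L * μmax * (∫ u, φ u) * h ^ β := by
        field_simp

/-- The expected matrix `𝔼 Ω̄` is uniformly positive definite. -/
theorem le_quadForm_mean {d l : ℕ} {β : ℝ} {K : E d → ℝ} (hK : IsKernel β K)
    {P : Measure (Z d)} [IsProbabilityMeasure P] {x : E d} {h c μmin ε : ℝ} {b : ℝ} (hh : 0 < h)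
    (hc : 0 ≤ c) (hμmin : 0 ≤ μmin)
    (hKc : ∀ u, ‖u‖ ≤ c → c ≤ K u) {S : Set (E d)} (hS : MeasurableSet S)
    (hSc : S ⊆ Metric.closedBall 0 c)
    (hν : P.fst.map (rescale x h) ≤ ENNReal.ofReal b • volume)
    (hνS : ENNReal.ofReal (μmin * h ^ d) • volume.restrict S ≤ P.fst.map (rescale x h))
    (hε : ∀ w : MultiIdx d l → ℝ, ε * ∑ s, w s ^ 2 ≤ ∫ u in S, polyEval w u ^ 2)
    (hint : ∀ s t : MultiIdx d l, Integrable (fun z : Z d =>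
      mono (rescale x h z.1) (s.1 + t.1) * K (rescale x h z.1)) P)
    (w : MultiIdx d l → ℝ) :
    c * μmin * ε * ∑ s, w s ^ 2 ≤ quadForm (fun s t : MultiIdx d l => 1 / h ^ d *
      ∫ z, mono (rescale x h z.1) (s.1 + t.1) * K (rescale x h z.1) ∂P) w := by
  have hKm := hK.measurable
  have hpm := measurable_polyEval w
  have hhd : 0 < h ^ d := pow_pos hh d
  have hq : quadForm (fun s t : MultiIdx d l => 1 / h ^ d *
      ∫ z, mono (rescale x h z.1) (s.1 + t.1) * K (rescale x h z.1) ∂P) w =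
      1 / h ^ d * ∫ z, polyEval w (rescale x h z.1) ^ 2 * K (rescale x h z.1) ∂P := by
    have h1 : ∀ z : Z d, polyEval w (rescale x h z.1) ^ 2 * K (rescale x h z.1) =
        ∑ s, ∑ t, w s * w t * (mono (rescale x h z.1) (s.1 + t.1) * K (rescale x h z.1)) := by
      intro z
      simp only [polyEval_sq, Finset.sum_mul, mul_assoc]
    simp only [h1]
    rw [integral_finsetSum _ fun s _ => integrable_finsetSum _ fun t _ => (hint s t).const_mul _,
      Finset.mul_sum]
    refine Finset.sum_congr rfl fun s _ => ?_
    rw [integral_finsetSum _ fun t _ => (hint s t).const_mul _, Finset.mul_sum]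
    refine Finset.sum_congr rfl fun t _ => ?_
    rw [integral_const_mul]
    ring
  have hintp : Integrable (fun z : Z d =>
      polyEval w (rescale x h z.1) ^ 2 * K (rescale x h z.1)) P := by
    simp only [polyEval_sq, Finset.sum_mul, mul_assoc]
    exact integrable_finsetSum _ fun s _ => integrable_finsetSum _ fun t _ =>
      ((hint s t).const_mul (w t)).const_mul (w s)
  have hpS : IntegrableOn (fun u : E d => polyEval w u ^ 2) S := by
    refine IntegrableOn.mono_set ?_ hSc
    refine ContinuousOn.integrableOn_compact (isCompact_closedBall _ _) (Continuous.continuousOn ?_)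
    exact (continuous_polyEval.comp (continuous_const.prodMk continuous_id)).pow 2
  -- only the part of the kernel on `S` is kept
  set ψ : E d → ℝ := S.indicator fun u => c * polyEval w u ^ 2 with hψ
  have hψm : Measurable ψ := ((hpm.pow_const 2).const_mul c).indicator hS
  have hψ0 : ∀ u, 0 ≤ ψ u := fun u => Set.indicator_nonneg (fun _ _ => by positivity) u
  have hψi : Integrable ψ := by
    rw [hψ, integrable_indicator_iff hS]
    exact hpS.const_mul c
  have hψν : Integrable ψ (P.fst.map (rescale x h)) :=
    (hψi.smul_measure ENNReal.ofReal_ne_top).mono_measure hν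
  have h2 : μmin * h ^ d * (c * ∫ u in S, polyEval w u ^ 2) ≤ ∫ z, ψ (rescale x h z.1) ∂P := by
    rw [integral_comp_rescale hψm]
    refine le_trans (le_of_eq ?_) (integral_mono_measure hνS (Eventually.of_forall hψ0) hψν)
    rw [integral_smul_measure, ENNReal.toReal_ofReal (by positivity), hψ,
      setIntegral_indicator hS, Set.inter_self, integral_const_mul, smul_eq_mul]
  have h3 : ∫ z, ψ (rescale x h z.1) ∂P ≤
      ∫ z, polyEval w (rescale x h z.1) ^ 2 * K (rescale x h z.1) ∂P := by
    refine integral_mono (integrable_comp_rescale hν hψi) hintp fun z => ?_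
    simp only [hψ]
    refine Set.indicator_apply_le' (fun hu => ?_) fun _ => mul_nonneg (sq_nonneg _) (hK.nonneg _)
    rw [mul_comm]
    exact mul_le_mul_of_nonneg_left (hKc _ (by simpa using hSc hu)) (sq_nonneg _)
  rw [hq]
  calc c * μmin * ε * ∑ s, w s ^ 2 = c * μmin * (ε * ∑ s, w s ^ 2) := by ring
    _ ≤ c * μmin * ∫ u in S, polyEval w u ^ 2 := by gcongr; exact hε w
    _ = 1 / h ^ d * (μmin * h ^ d * (c * ∫ u in S, polyEval w u ^ 2)) := by field_simp
    _ ≤ _ := by gcongr; exact h2.trans h3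

/-- Perturbation of a quadratic form in terms of the entries of the matrix. -/
theorem le_quadForm_of_abs_sub_le {ι : Type*} [Fintype ι] {M M' : ι → ι → ℝ} {t ε : ℝ}
    (hM : ∀ w, t * ∑ s, w s ^ 2 ≤ quadForm M w) (hε : ∀ s t, |M' s t - M s t| ≤ ε) (w : ι → ℝ) :
    (t - Fintype.card ι * ε) * ∑ s, w s ^ 2 ≤ quadForm M' w := by
  have h1 : quadForm M w - quadForm M' w ≤ Fintype.card ι * ε * ∑ s, w s ^ 2 := by
    calc quadForm M w - quadForm M' w = ∑ s, ∑ t, w s * w t * (M s t - M' s t) := by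
          simp only [quadForm, ← Finset.sum_sub_distrib]
          exact Finset.sum_congr rfl fun s _ => Finset.sum_congr rfl fun t _ => by ring
      _ ≤ ∑ s, ∑ t, (w s ^ 2 + w t ^ 2) / 2 * ε := by
          refine Finset.sum_le_sum fun s _ => Finset.sum_le_sum fun t _ => ?_
          refine (le_abs_self _).trans ?_
          rw [abs_mul, abs_sub_comm]
          refine mul_le_mul ?_ (hε s t) (abs_nonneg _) (by positivity)
          rw [abs_mul]
          nlinarith [sq_nonneg (|w s| - |w t|), sq_abs (w s), sq_abs (w t)]
      _ = _ := by
          simp only [← Finset.sum_mul, ← Finset.sum_div, Finset.sum_add_distrib, Finset.sum_const,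
            Finset.card_univ, nsmul_eq_mul, ← Finset.mul_sum]
          ring
  linarith [hM w]

/-! ### The probability of a wrong decision at a point -/

/-- If the plug-in rules of two functions differ at a point, then the values of the functions
differ by at least the distance of either of them from the threshold `1/2`. -/
theorem abs_sub_half_le_of_plugIn_ne {d : ℕ} {f g : E d → ℝ} {x : E d}
    (h : plugIn f x ≠ plugIn g x) : |g x - 1 / 2| ≤ |f x - g x| := by
  unfold plugIn at h
  split_ifs at h with h1 h2 h2
  · exact absurd rfl h
  · rw [abs_of_nonpos (by linarith), abs_of_nonneg (by linarith)]
    linarith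
  · rw [abs_of_nonneg (by linarith), abs_of_nonpos (by linarith)]
    linarith
  · exact absurd rfl h

/-- With the bandwidth `h = n^{-1/(2β+d)}`, the effective sample size `n h^d` is `h^{-2β}`. -/
theorem natCast_mul_bandwidth_pow {d n : ℕ} {β : ℝ} (hβ : 0 < β) (hn : 0 < n) :
    (n : ℝ) * ((n : ℝ) ^ (-(1 / (2 * β + d)))) ^ d =
      ((((n : ℝ) ^ (-(1 / (2 * β + d)))) ^ β) ^ 2)⁻¹ := by
  have hn' : (0 : ℝ) < n := by exact_mod_cast hn
  have hD : 2 * β + d ≠ 0 := by positivity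
  rw [← Real.rpow_natCast _ d, ← Real.rpow_natCast _ 2, ← Real.rpow_mul hn'.le,
    ← Real.rpow_mul hn'.le, ← Real.rpow_mul hn'.le, ← Real.rpow_neg hn'.le]
  nth_rewrite 1 [← Real.rpow_one (n : ℝ)]
  rw [← Real.rpow_add hn']
  congr 1
  push_cast
  field_simp
  ring

/-- The deviation events of the entries of `Ω̄` and of the components of the residual contain the
event of a wrong decision at `x`, when `|η(x) - 1/2|` is large compared with the bias. -/
theorem exists_deviation_of_ne {d n : ℕ} {β : ℝ} {K : E d → ℝ} {h : ℝ} (hh : 0 < h) (hn : 1 < n)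
    {x : E d} {η : E d → ℝ} {τ : ℝ} (hτ : (Real.log n)⁻¹ < τ)
    {T : MultiIdx d (floorLT β) → ℝ} (hT : T (zeroIdx d _) = η x) (h0 : 0 ≤ η x) (h1 : η x ≤ 1)
    {M : MultiIdx d (floorLT β) → MultiIdx d (floorLT β) → ℝ} {W : MultiIdx d (floorLT β) → ℝ}
    {ε₁ ε₂ b : ℝ}
    (hM : ∀ w, (τ + Fintype.card (MultiIdx d (floorLT β)) * ε₁) * ∑ s, w s ^ 2 ≤ quadForm M w)
    (hW : ∀ s, |W s| ≤ b)
    (hb : Fintype.card (MultiIdx d (floorLT β)) * (ε₂ + b) / τ < |η x - 1 / 2|)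
    {ω : Fin n → Z d} (hω : plugIn (etaStar β K h ω) x ≠ plugIn η x) :
    (∃ s t, ε₁ ≤ |omegaBar (floorLT β) K h ω x s t - M s t|) ∨
      ∃ s, ε₂ ≤ |lpResidual K h ω x T s - W s| := by
  by_contra! hcon
  obtain ⟨hA, hB⟩ := hcon
  have hq : ∀ w, τ * ∑ s, w s ^ 2 ≤ quadForm (omegaBar (floorLT β) K h ω x) w := by
    intro w
    have := le_quadForm_of_abs_sub_le hM (fun s t => (hA s t).le) w
    rwa [add_sub_cancel_right] at this
  have hres : ∀ s, |lpResidual K h ω x T s| ≤ ε₂ + b := by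
    intro s
    have : lpResidual K h ω x T s = (lpResidual K h ω x T s - W s) + W s := by ring
    rw [this]
    exact (abs_add_le _ _).trans (add_le_add (hB s).le (hW s))
  have := abs_etaStar_sub_le K hh hn ω x hτ hq (hT ▸ h0) (hT ▸ h1) hres
  rw [hT] at this
  exact absurd (this.trans_lt hb) (not_lt.2 (abs_sub_half_le_of_plugIn_ne hω))

/-- The pointwise bound: the probability of a wrong decision at `x` is sub-Gaussian in
`|η(x) - 1/2| / h^β`, with constants that do not depend on the distribution or on `x`. -/
theorem exists_pointwise_bound {d : ℕ} {β L c₀ r₀ μmin μmax : ℝ} (hβ : 0 < β) (hL : 0 < L)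
    (hc₀ : 0 < c₀) (hr₀ : 0 < r₀) (hμmin : 0 < μmin) (hμmax : 0 < μmax) {K : E d → ℝ}
    (hK : IsKernel β K) :
    ∃ C₁ c₂ : ℝ, ∃ n₀ : ℕ, 0 < C₁ ∧ 0 < c₂ ∧ ∀ n : ℕ, n₀ ≤ n →
      ∀ (P : Measure (Z d)) [IsProbabilityMeasure P] (η : E d → ℝ), IsRegressionFun P η →
      η ∈ holderClass d β L → ∀ (A : Set (E d)) (μ : E d → ℝ), IsCompact A →
      IsRegularSet c₀ r₀ A → (∀ x ∈ A, μmin ≤ μ x ∧ μ x ≤ μmax) → (∀ x ∉ A, μ x = 0) →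
      P.fst = volume.withDensity (fun x => ENNReal.ofReal (μ x)) →
      ∀ x ∈ A, 0 ≤ η x → η x ≤ 1 → η x ≠ 1 / 2 →
      (Measure.pi fun _ : Fin n => P).real {ω | fStar n β K ω x ≠ plugIn η x} ≤
        C₁ * Real.exp (-(c₂ * (|η x - 1 / 2| / ((n : ℝ) ^ (-(1 / (2 * β + d)))) ^ β) ^ 2)) := by
  obtain ⟨c, hc, hKc⟩ := hK.lower
  have hKm := hK.measurable
  have hvol : 0 < volume.real (Metric.closedBall (0 : E d) c) :=
    ENNReal.toReal_pos (Metric.measure_closedBall_pos volume _ hc).ne'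
      measure_closedBall_lt_top.ne
  obtain ⟨ε₀, hε₀, hlow⟩ := exists_le_setIntegral_sq d (floorLT β) c (mul_pos hc₀ hvol)
  obtain ⟨rA, hrA, HA⟩ := exists_concentration hK (a := 1) zero_le_one hμmax.le
  obtain ⟨rB, hrB, HB⟩ := exists_concentration hK (a := 1 + L) (by positivity) hμmax.le
  set D : ℝ := (Fintype.card (MultiIdx d (floorLT β)) : ℝ) with hD
  have hD0 : 0 < D := by
    rw [hD]
    exact_mod_cast Fintype.card_pos
  set τ : ℝ := c * μmin * ε₀ / 2 with hτ
  have hτ0 : 0 < τ := by positivity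
  set ε₁ : ℝ := min 1 (τ / D) with hε₁
  have hε₁0 : 0 < ε₁ := lt_min one_pos (by positivity)
  have hε₁τ : D * ε₁ ≤ τ := by
    have : ε₁ ≤ τ / D := min_le_right _ _
    rwa [le_div_iff₀ hD0, mul_comm] at this
  set κ : ℝ := min 1 (τ / (4 * D)) with hκ
  have hκ0 : 0 < κ := lt_min one_pos (by positivity)
  have hκτ : D * κ ≤ τ / 4 := by
    have : κ ≤ τ / (4 * D) := min_le_right _ _
    rw [le_div_iff₀ (by positivity)] at this
    linarith
  set Cb : ℝ := L * μmax * ∫ u, (1 + ‖u‖ ^ (β + floorLT β)) * K u with hCb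
  have hCb0 : 0 ≤ Cb := mul_nonneg (by positivity)
    (integral_nonneg fun u => mul_nonneg (by positivity) (hK.nonneg u))
  set C₃ : ℝ := 4 * D * Cb / τ with hC₃
  set c₂ : ℝ := min (rA * ε₁ ^ 2) (rB * κ ^ 2) with hc₂
  have hc₂0 : 0 < c₂ := lt_min (by positivity) (by positivity)
  -- the bandwidth and the eigenvalue threshold are small for large `n`
  have hev : ∀ᶠ n : ℕ in atTop, 1 < n ∧ (Real.log n)⁻¹ < τ ∧
      (n : ℝ) ^ (-(1 / (2 * β + d))) * c ≤ r₀ := by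
    have h1 : Tendsto (fun n : ℕ => (Real.log n)⁻¹) atTop (nhds 0) :=
      tendsto_inv_atTop_zero.comp (Real.tendsto_log_atTop.comp tendsto_natCast_atTop_atTop)
    have h2 : Tendsto (fun n : ℕ => (n : ℝ) ^ (-(1 / (2 * β + d))) * c) atTop (nhds 0) := by
      have := ((tendsto_rpow_neg_atTop (show 0 < 1 / (2 * β + d) by positivity)).comp
        tendsto_natCast_atTop_atTop).mul_const c
      simpa using this
    filter_upwards [eventually_gt_atTop 1, h1.eventually_lt_const hτ0,
      h2.eventually_lt_const hr₀] with n hn1 hn2 hn3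
    exact ⟨hn1, hn2, hn3.le⟩
  obtain ⟨n₀, hn₀⟩ := eventually_atTop.1 hev
  refine ⟨2 * D ^ 2 + 2 * D + Real.exp (c₂ * C₃ ^ 2), c₂, n₀, by positivity, hc₂0, ?_⟩
  intro n hn P _ η hη hηH A μ hAc hAr hA hA0 hPX x hx hη0 hη1 hηne
  obtain ⟨hn1, hnτ, hnr⟩ := hn₀ n hn
  have hnpos : 0 < n := by omega
  have hNB := natCast_mul_bandwidth_pow (d := d) hβ hnpos
  have hh : 0 < (n : ℝ) ^ (-(1 / (2 * β + d))) := Real.rpow_pos_of_pos (by exact_mod_cast hnpos) _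
  have hh1 : (n : ℝ) ^ (-(1 / (2 * β + d))) ≤ 1 := by
    refine Real.rpow_le_one_of_one_le_of_nonpos (by exact_mod_cast hnpos) ?_
    rw [neg_nonpos]
    positivity
  unfold fStar
  set h : ℝ := (n : ℝ) ^ (-(1 / (2 * β + d))) with hhdef
  have hhβ : 0 < h ^ β := Real.rpow_pos_of_pos hh _
  set δ : ℝ := |η x - 1 / 2| with hδ
  have hδ0 : 0 < δ := abs_pos.2 (sub_ne_zero.2 hηne)
  have hδ1 : δ ≤ 1 := by
    rw [hδ, abs_le]
    constructor <;> linarith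
  -- below the bias level the bound is trivial
  by_cases hsmall : δ < C₃ * h ^ β
  · refine measureReal_le_one.trans ?_
    have h1 : δ / h ^ β ≤ C₃ := (div_le_iff₀ hhβ).2 hsmall.le
    have h2 : 0 ≤ δ / h ^ β := by positivity
    calc (1 : ℝ) = Real.exp (c₂ * C₃ ^ 2) * Real.exp (-(c₂ * C₃ ^ 2)) := by
          rw [← Real.exp_add, add_neg_cancel, Real.exp_zero]
      _ ≤ (2 * D ^ 2 + 2 * D + Real.exp (c₂ * C₃ ^ 2)) *
          Real.exp (-(c₂ * (δ / h ^ β) ^ 2)) := by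
          refine mul_le_mul (le_add_of_nonneg_left (by positivity)) (Real.exp_le_exp.2 ?_)
            (Real.exp_pos _).le (by positivity)
          have := pow_le_pow_left₀ h2 h1 2
          nlinarith
  push Not at hsmall
  have hν := map_rescale_le hμmax.le (fun x hx => (hA x hx).2) hA0 hPX x hh
  obtain ⟨S, hSm, hSc, hSvol, hνS⟩ := exists_restrict_le_map_rescale hAc hAr hμmin.le
    (fun x hx => (hA x hx).1) hPX hx hh hc hnr
  have hSvol' : ENNReal.ofReal (c₀ * volume.real (Metric.closedBall (0 : E d) c)) ≤ volume S := by
    rw [ENNReal.ofReal_mul hc₀.le, Measure.real, ENNReal.ofReal_toReal measure_closedBall_lt_top.ne]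
    exact hSvol
  set T := taylorCoeff (floorLT β) η x h with hT
  have hTη : ∀ y, |η y - polyEval T (rescale x h y)| ≤ L * h ^ β * ‖rescale x h y‖ ^ β :=
    fun y => abs_sub_polyEval_taylorCoeff_le hηH x hh y
  have hpm := measurable_polyEval T
  set gA : MultiIdx d (floorLT β) → MultiIdx d (floorLT β) → Z d → ℝ := fun s t z =>
    mono (rescale x h z.1) (s.1 + t.1) * K (rescale x h z.1) with hgA
  set gB : MultiIdx d (floorLT β) → Z d → ℝ := fun s z =>
    (label z.2 - polyEval T (rescale x h z.1)) * mono (rescale x h z.1) s.1 *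
      K (rescale x h z.1) with hgB
  have hgAm : ∀ s t, Measurable (gA s t) := fun s t => by fun_prop
  have hgBm : ∀ s, Measurable (gB s) := fun s => by fun_prop
  have hgAb : ∀ s t z, |gA s t z| ≤
      1 * ((1 + ‖rescale x h z.1‖ ^ (2 * β)) * K (rescale x h z.1)) :=
    fun s t z => abs_gram_summand_le hβ hK.nonneg s t _
  have hη01 : ∀ᵐ z ∂P, 0 ≤ η z.1 ∧ η z.1 ≤ 1 := by
    refine ae_of_ae_map measurable_fst.aemeasurable (p := fun y => 0 ≤ η y ∧ η y ≤ 1) ?_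
    filter_upwards [hη] with y hy
    rw [hy]
    exact regressionFun_mem P y
  have hgBb : ∀ s, ∀ᵐ z ∂P, |gB s z| ≤
      (1 + L) * ((1 + ‖rescale x h z.1‖ ^ (2 * β)) * K (rescale x h z.1)) := by
    intro s
    filter_upwards [hη01] with z hz
    refine abs_residual_summand_le hβ hL.le hK.nonneg s _ (abs_label_sub_le hz.1 hz.2)
      ((hTη z.1).trans ?_)
    exact mul_le_mul_of_nonneg_right
      (mul_le_of_le_one_right hL.le (Real.rpow_le_one hh.le hh1 hβ.le)) (by positivity)
  obtain ⟨MK, hMK⟩ := hK.bounded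
  have hgAi : ∀ s t, Integrable (gA s t) P := fun s t =>
    Integrable.of_bound (hgAm s t).aestronglyMeasurable MK (Eventually.of_forall fun z =>
      ((hgAb s t z).trans (by rw [one_mul])).trans (hMK _))
  have hM : ∀ w, (τ + D * ε₁) * ∑ s, w s ^ 2 ≤
      quadForm (fun s t => 1 / h ^ d * ∫ z, gA s t z ∂P) w := by
    intro w
    refine le_trans ?_ (le_quadForm_mean hK hh hc.le hμmin.le hKc hSm hSc hν hνS
      (hlow S hSm hSc hSvol') hgAi w)
    refine mul_le_mul_of_nonneg_right ?_ (Finset.sum_nonneg fun _ _ => sq_nonneg _)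
    have : c * μmin * ε₀ = τ + τ := by rw [hτ]; ring
    linarith
  have hW : ∀ s, |1 / h ^ d * ∫ z, gB s z ∂P| ≤ Cb * h ^ β := fun s =>
    abs_mean_residual_le hβ hL.le hK hη hh hh1 hμmax.le hν hTη s
  have hb : D * (κ * δ + Cb * h ^ β) / τ < δ := by
    have h1 : D * Cb * h ^ β ≤ τ / 4 * δ := by
      have h2 : C₃ * h ^ β = 4 * (D * Cb * h ^ β) / τ := by rw [hC₃]; ring
      rw [h2, div_le_iff₀ hτ0] at hsmall
      linarith
    rw [div_lt_iff₀ hτ0]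
    nlinarith [mul_le_mul_of_nonneg_right hκτ hδ0.le, mul_pos hδ0 hτ0]
  have hsub : {ω : Fin n → Z d | plugIn (etaStar β K h ω) x ≠ plugIn η x} ⊆
      (⋃ s, ⋃ t, {ω | ε₁ ≤ |1 / (n * h ^ d) * ∑ i, gA s t (ω i) -
        1 / h ^ d * ∫ z, gA s t z ∂P|}) ∪
      ⋃ s, {ω | κ * δ ≤ |1 / (n * h ^ d) * ∑ i, gB s (ω i) - 1 / h ^ d * ∫ z, gB s z ∂P|} := by
    intro ω hω
    rcases exists_deviation_of_ne hh hn1 hnτ (taylorCoeff_zeroIdx _ η x h) hη0 hη1 hM hW hb hω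
      with ⟨s, t, hst⟩ | ⟨s, hs⟩
    · exact Or.inl (Set.mem_iUnion.2 ⟨s, Set.mem_iUnion.2 ⟨t, hst⟩⟩)
    · exact Or.inr (Set.mem_iUnion.2 ⟨s, hs⟩)
  set X : ℝ := Real.exp (-(c₂ * (δ / h ^ β) ^ 2)) with hX
  have hNδ : n * h ^ d * δ ^ 2 = (δ / h ^ β) ^ 2 := by
    rw [hNB, div_pow, inv_mul_eq_div]
  have hN0 : 0 < n * h ^ d := by positivity
  have hA' : ∀ s t, (Measure.pi fun _ : Fin n => P).real {ω | ε₁ ≤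
      |1 / (n * h ^ d) * ∑ i, gA s t (ω i) - 1 / h ^ d * ∫ z, gA s t z ∂P|} ≤ 2 * X := by
    intro s t
    refine (HA P x h hh hν (gA s t) (hgAm s t) (Eventually.of_forall (hgAb s t)) ε₁ hε₁0
      (min_le_left _ _) n hnpos).trans ?_
    refine mul_le_mul_of_nonneg_left (Real.exp_le_exp.2 (neg_le_neg ?_)) zero_le_two
    calc c₂ * (δ / h ^ β) ^ 2 ≤ rA * ε₁ ^ 2 * (δ / h ^ β) ^ 2 := by
          gcongr
          exact min_le_left _ _
      _ = rA * ε₁ ^ 2 * (n * h ^ d) * δ ^ 2 := by rw [← hNδ]; ring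
      _ ≤ rA * ε₁ ^ 2 * (n * h ^ d) * 1 := by
          gcongr
          exact pow_le_one₀ hδ0.le hδ1
      _ = _ := by ring
  have hB' : ∀ s, (Measure.pi fun _ : Fin n => P).real {ω | κ * δ ≤
      |1 / (n * h ^ d) * ∑ i, gB s (ω i) - 1 / h ^ d * ∫ z, gB s z ∂P|} ≤ 2 * X := by
    intro s
    refine (HB P x h hh hν (gB s) (hgBm s) (hgBb s) (κ * δ) (by positivity)
      (mul_le_one₀ (min_le_left _ _) hδ0.le hδ1) n hnpos).trans ?_
    refine mul_le_mul_of_nonneg_left (Real.exp_le_exp.2 (neg_le_neg ?_)) zero_le_two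
    calc c₂ * (δ / h ^ β) ^ 2 ≤ rB * κ ^ 2 * (δ / h ^ β) ^ 2 := by
          gcongr
          exact min_le_right _ _
      _ = rB * (n * h ^ d) * (κ * δ) ^ 2 := by rw [← hNδ]; ring
  have hX0 : 0 < X := Real.exp_pos _
  refine (measureReal_mono hsub).trans ((measureReal_union_le _ _).trans ?_)
  have hsumA : (Measure.pi fun _ : Fin n => P).real (⋃ s, ⋃ t, {ω | ε₁ ≤
      |1 / (n * h ^ d) * ∑ i, gA s t (ω i) - 1 / h ^ d * ∫ z, gA s t z ∂P|}) ≤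
      2 * D ^ 2 * X := by
    refine (measureReal_iUnion_fintype_le _).trans ?_
    refine (Finset.sum_le_sum fun s _ => (measureReal_iUnion_fintype_le _).trans
      (Finset.sum_le_sum fun t _ => hA' s t)).trans (le_of_eq ?_)
    simp only [Finset.sum_const, Finset.card_univ, nsmul_eq_mul, ← hD]
    ring
  have hsumB : (Measure.pi fun _ : Fin n => P).real (⋃ s, {ω | κ * δ ≤
      |1 / (n * h ^ d) * ∑ i, gB s (ω i) - 1 / h ^ d * ∫ z, gB s z ∂P|}) ≤ 2 * D * X := by
    refine (measureReal_iUnion_fintype_le _).trans ?_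
    refine (Finset.sum_le_sum fun s _ => hB' s).trans (le_of_eq ?_)
    simp only [Finset.sum_const, Finset.card_univ, nsmul_eq_mul, ← hD]
    ring
  have : 0 ≤ Real.exp (c₂ * C₃ ^ 2) * X := by positivity
  linarith

/-! ### The excess risk -/

theorem risk_eq {d : ℕ} {P : Measure (Z d)} [IsProbabilityMeasure P] {f : E d → Fin 2}
    (hf : Measurable f) :
    risk P f = ∫ x, (if f x = 0 then regressionFun P x else 1 - regressionFun P x) ∂P.fst := by
  have hS : MeasurableSet {z : Z d | z.2 ≠ f z.1} :=
    (measurableSet_eq_fun measurable_snd (hf.comp measurable_fst)).compl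
  have hint : Integrable ({z : Z d | z.2 ≠ f z.1}.indicator fun _ => (1 : ℝ)) P :=
    (integrable_const 1).indicator hS
  have h1 : risk P f = ∫ z, {z : Z d | z.2 ≠ f z.1}.indicator (fun _ => (1 : ℝ)) z ∂P := by
    rw [integral_indicator_const _ hS]
    simp [risk]
  rw [h1, integral_eq_integral_fst (η := regressionFun P) (EventuallyEq.refl _ _) hint]
  refine integral_congr_ae (Eventually.of_forall fun x => ?_)
  simp only [Set.indicator_apply, Set.mem_ofPred_eq]
  rcases (by omega : f x = 0 ∨ f x = 1) with h | h <;> simp [h]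

/-- The excess risk of a deterministic rule. -/
theorem risk_sub_risk_bayesRule {d : ℕ} {P : Measure (Z d)} [IsProbabilityMeasure P]
    {f : E d → Fin 2} (hf : Measurable f) :
    risk P f - risk P (bayesRule P) =
      ∫ x, |2 * regressionFun P x - 1| * {x | f x ≠ bayesRule P x}.indicator 1 x ∂P.fst := by
  classical
  have hrm := measurable_regressionFun P
  have hb : Measurable (bayesRule P) :=
    Measurable.ite (measurableSet_le measurable_const hrm) measurable_const measurable_const
  have hint : ∀ f : E d → Fin 2, Measurable f → Integrable
      (fun x => if f x = 0 then regressionFun P x else 1 - regressionFun P x) P.fst := by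
    intro f hf
    refine Integrable.of_bound (Measurable.aestronglyMeasurable
      (Measurable.ite (hf (measurableSet_singleton 0)) hrm (by fun_prop))) 1
      (Eventually.of_forall fun x => ?_)
    have := regressionFun_mem P x
    rw [Real.norm_eq_abs, abs_le]
    split_ifs <;> constructor <;> linarith
  rw [risk_eq hf, risk_eq hb, ← integral_sub (hint f hf) (hint _ hb)]
  refine integral_congr_ae (Eventually.of_forall fun x => ?_)
  have h01 : ∀ i : Fin 2, i ≠ 0 ↔ i = 1 := by decide
  simp only [Set.indicator_apply, Set.mem_ofPred_eq, Pi.one_apply]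
  by_cases hr : 1 / 2 ≤ regressionFun P x
  · have hbx : bayesRule P x = 1 := if_pos hr
    rw [hbx, abs_of_nonneg (by linarith)]
    by_cases hfx : f x = 0
    · simp [hfx]
      ring
    · simp [(h01 _).1 hfx]
  · have hbx : bayesRule P x = 0 := if_neg hr
    rw [hbx, abs_of_nonpos (by linarith)]
    by_cases hfx : f x = 0
    · simp [hfx]
    · simp [(h01 _).1 hfx]
      ring

/-- The excess risk of an empirical rule is the integral of `|2η(x) - 1|` times the probability of
a decision at `x` that differs from the Bayes rule. -/
theorem excessRisk_eq {d n : ℕ} {P : Measure (Z d)} [IsProbabilityMeasure P]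
    {f : (Fin n → Z d) → E d → Fin 2}
    (hf : Measurable fun p : (Fin n → Z d) × E d => f p.1 p.2) :
    excessRisk P f = ∫ x, |2 * regressionFun P x - 1| *
      (Measure.pi fun _ : Fin n => P).real {ω | f ω x ≠ bayesRule P x} ∂P.fst := by
  classical
  set ν := Measure.pi fun _ : Fin n => P with hν
  have hrm := measurable_regressionFun P
  have hb : Measurable (bayesRule P) :=
    Measurable.ite (measurableSet_le measurable_const hrm) measurable_const measurable_const
  have hfω : ∀ ω, Measurable (f ω) := fun ω => hf.comp measurable_prodMk_left
  have hfx : ∀ x, Measurable fun ω => f ω x := fun x => hf.comp measurable_prodMk_right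
  set F : (Fin n → Z d) × E d → ℝ := fun p =>
    |2 * regressionFun P p.2 - 1| * {p : (Fin n → Z d) × E d |
      f p.1 p.2 ≠ bayesRule P p.2}.indicator 1 p with hF
  have hFm : Measurable F := by
    refine Measurable.mul (by fun_prop) (measurable_one.indicator ?_)
    exact (measurableSet_eq_fun hf (hb.comp measurable_snd)).compl
  have hFi : Integrable F (ν.prod P.fst) := by
    refine Integrable.of_bound hFm.aestronglyMeasurable 1 (Eventually.of_forall fun p => ?_)
    have h1 := regressionFun_mem P p.2
    have h2 : |2 * regressionFun P p.2 - 1| ≤ 1 := by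
      rw [abs_le]
      constructor <;> linarith
    simp only [hF, Set.indicator_apply, Real.norm_eq_abs, Pi.one_apply]
    split_ifs <;> simp [h2]
  have h1 : ∀ ω, risk P (f ω) = risk P (bayesRule P) + ∫ x, F (ω, x) ∂P.fst := by
    intro ω
    have := risk_sub_risk_bayesRule (P := P) (hfω ω)
    linarith [show ∫ x, F (ω, x) ∂P.fst = risk P (f ω) - risk P (bayesRule P) from this.symm]
  have h2 : Integrable (fun ω => ∫ x, F (ω, x) ∂P.fst) ν := hFi.integral_prod_left
  rw [excessRisk]
  simp only [h1]
  rw [integral_add (integrable_const _) h2, integral_integral_swap hFi]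
  simp only [integral_const, probReal_univ, one_smul, add_sub_cancel_left]
  refine integral_congr_ae (Eventually.of_forall fun x => ?_)
  simp only [hF]
  rw [integral_const_mul]
  congr 1
  have hS : MeasurableSet {ω | f ω x ≠ bayesRule P x} :=
    (measurableSet_eq_fun (hfx x) measurable_const).compl
  rw [← integral_indicator_one hS]
  rfl

/-! ### Peeling -/

theorem summable_rpow_mul_exp_neg_sq (a : ℝ) {c : ℝ} (hc : 0 < c) :
    Summable fun j : ℕ => ((j : ℝ) + 1) ^ a * Real.exp (-(c * (j : ℝ) ^ 2)) := by
  have h1 := (summable_nat_add_iff 1).2 (Real.summable_pow_mul_exp_neg_nat_mul ⌈a⌉₊ hc)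
  refine Summable.of_nonneg_of_le (fun j => by positivity) (fun j => ?_)
    (h1.mul_left (Real.exp c))
  push_cast
  have h2 : ((j : ℝ) + 1) ^ a ≤ ((j : ℝ) + 1) ^ ⌈a⌉₊ := by
    rw [← Real.rpow_natCast]
    exact Real.rpow_le_rpow_of_exponent_le (by linarith [j.cast_nonneg (α := ℝ)]) (Nat.le_ceil a)
  have h3 : Real.exp (-(c * (j : ℝ) ^ 2)) ≤ Real.exp c * Real.exp (-c * ((j : ℝ) + 1)) := by
    rw [← Real.exp_add]
    refine Real.exp_le_exp.2 ?_
    have : (j : ℝ) ≤ (j : ℝ) ^ 2 := by exact_mod_cast Nat.le_self_pow two_ne_zero j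
    nlinarith
  calc _ ≤ ((j : ℝ) + 1) ^ ⌈a⌉₊ * (Real.exp c * Real.exp (-c * ((j : ℝ) + 1))) := by gcongr
    _ = _ := by ring

/-- Under a margin condition on `g`, a function with sub-Gaussian decay in `|g|/δ` integrates to
`O(δ^{1+α})`: the range of `|g|/δ` is cut into the unit shells `[j, j+1)`. -/
theorem integral_le_of_margin {Ω : Type*} [MeasurableSpace Ω] {PX : Measure Ω}
    [IsFiniteMeasure PX] {g F : Ω → ℝ} (hg : Measurable g) (hg1 : ∀ᵐ x ∂PX, |g x| ≤ 1)
    {C₀ α C₁ c δ : ℝ} (hC₀ : 0 ≤ C₀) (hC₁ : 0 ≤ C₁) (hc : 0 < c) (hδ : 0 < δ)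
    (hmargin : ∀ t, 0 < t → PX.real {x | 0 < |g x| ∧ |g x| ≤ t} ≤ C₀ * t ^ α)
    (hF0 : ∀ x, 0 ≤ F x)
    (hF : ∀ᵐ x ∂PX, F x ≤ 2 * |g x| * (C₁ * Real.exp (-(c * (|g x| / δ) ^ 2)))) :
    ∫ x, F x ∂PX ≤ 2 * C₁ * C₀ *
      (∑' j : ℕ, ((j : ℝ) + 1) ^ (1 + α) * Real.exp (-(c * (j : ℝ) ^ 2))) * δ ^ (1 + α) := by
  set J : ℕ := ⌊1 / δ⌋₊ + 1 with hJ
  set B : ℕ → Set Ω := fun j => {x | 0 < |g x| ∧ |g x| ≤ ((j : ℝ) + 1) * δ} with hB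
  have hBm : ∀ j, MeasurableSet (B j) := fun j =>
    (measurableSet_lt measurable_const hg.abs).inter (measurableSet_le hg.abs measurable_const)
  set w : ℕ → ℝ := fun j => 2 * (((j : ℝ) + 1) * δ) * (C₁ * Real.exp (-(c * (j : ℝ) ^ 2))) with hw
  have hw0 : ∀ j, 0 ≤ w j := fun j => by positivity
  have hGi : ∀ j, Integrable ((B j).indicator fun _ => w j) PX := fun j =>
    (integrable_const _).indicator (hBm j)
  calc ∫ x, F x ∂PX ≤ ∫ x, ∑ j ∈ Finset.range J, (B j).indicator (fun _ => w j) x ∂PX := by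
        refine integral_mono_of_nonneg (Eventually.of_forall hF0)
          (integrable_finsetSum _ fun j _ => hGi j) ?_
        filter_upwards [hF, hg1] with x hx hgx
        have hnn : ∀ j ∈ Finset.range J, 0 ≤ (B j).indicator (fun _ => w j) x :=
          fun j _ => Set.indicator_nonneg (fun _ _ => hw0 j) x
        rcases (abs_nonneg (g x)).eq_or_lt with h0 | h0
        · rw [← h0] at hx
          exact hx.trans ((by simp : _ = (0 : ℝ)).le.trans (Finset.sum_nonneg hnn))
        have hu : 0 ≤ |g x| / δ := by positivity
        have h1 := Nat.floor_le hu
        have h2 := Nat.lt_floor_add_one (|g x| / δ)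
        set j := ⌊|g x| / δ⌋₊ with hj
        have hjJ : j ∈ Finset.range J := by
          rw [Finset.mem_range, hJ, Nat.lt_succ_iff]
          exact Nat.floor_le_floor (by gcongr)
        have hle : |g x| ≤ ((j : ℝ) + 1) * δ := ((div_lt_iff₀ hδ).1 h2).le
        refine hx.trans (le_trans ?_ (Finset.single_le_sum hnn hjJ))
        rw [Set.indicator_of_mem (show x ∈ B j from ⟨h0, hle⟩)]
        simp only [hw]
        gcongr
    _ = ∑ j ∈ Finset.range J, w j * PX.real (B j) := by
        rw [integral_finsetSum _ fun j _ => hGi j]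
        refine Finset.sum_congr rfl fun j _ => ?_
        rw [integral_indicator_const _ (hBm j), smul_eq_mul, mul_comm]
    _ ≤ ∑ j ∈ Finset.range J, 2 * C₁ * C₀ * δ ^ (1 + α) *
          (((j : ℝ) + 1) ^ (1 + α) * Real.exp (-(c * (j : ℝ) ^ 2))) := by
        refine Finset.sum_le_sum fun j _ => ?_
        have hj1 : (0 : ℝ) < (j : ℝ) + 1 := by positivity
        calc w j * PX.real (B j) ≤ w j * (C₀ * (((j : ℝ) + 1) * δ) ^ α) :=
              mul_le_mul_of_nonneg_left (hmargin _ (by positivity)) (hw0 j)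
          _ = _ := by
              rw [Real.mul_rpow hj1.le hδ.le, Real.rpow_add hδ, Real.rpow_add hj1,
                Real.rpow_one, Real.rpow_one]
              ring
    _ ≤ 2 * C₁ * C₀ * δ ^ (1 + α) *
          ∑' j : ℕ, ((j : ℝ) + 1) ^ (1 + α) * Real.exp (-(c * (j : ℝ) ^ 2)) := by
        rw [← Finset.mul_sum]
        refine mul_le_mul_of_nonneg_left ?_ (by positivity)
        exact (summable_rpow_mul_exp_neg_sq (1 + α) hc).sum_le_tsum _ fun j _ => by positivity
    _ = _ := by ring

/-! ### The rate of convergence -/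

theorem excessRisk_le_one {d n : ℕ} {P : Measure (Z d)} [IsProbabilityMeasure P]
    {f : (Fin n → Z d) → E d → Fin 2}
    (hf : Measurable fun p : (Fin n → Z d) × E d => f p.1 p.2) : excessRisk P f ≤ 1 := by
  rw [excessRisk_eq hf]
  refine (integral_mono_of_nonneg (Eventually.of_forall fun x => by positivity)
    (integrable_const (1 : ℝ)) (Eventually.of_forall fun x => ?_)).trans (by simp)
  refine mul_le_one₀ ?_ measureReal_nonneg measureReal_le_one
  have := regressionFun_mem P x
  rw [abs_le]
  constructor <;> linarith

theorem isLittleO_rpow_neg_iff (r : ℝ) :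
    (fun n : ℕ => (n : ℝ) ^ (-r)) =o[atTop] (fun n : ℕ => 1 / (n : ℝ)) ↔ 1 < r := by
  have h1 : (fun n : ℕ => (n : ℝ) ^ (-r)) =o[atTop] (fun n : ℕ => 1 / (n : ℝ)) ↔
      Tendsto (fun n : ℕ => (n : ℝ) ^ (-r) / (1 / (n : ℝ))) atTop (nhds 0) := by
    refine isLittleO_iff_tendsto' ?_
    filter_upwards [eventually_gt_atTop 0] with n hn h0
    have : (n : ℝ) ≠ 0 := by exact_mod_cast hn.ne'
    simp [this] at h0
  have h2 : (fun n : ℕ => (n : ℝ) ^ (-r) / (1 / (n : ℝ))) =ᶠ[atTop]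
      fun n : ℕ => (n : ℝ) ^ (-(r - 1)) := by
    filter_upwards [eventually_gt_atTop 0] with n hn
    have : (0 : ℝ) < n := by exact_mod_cast hn
    rw [div_div_eq_mul_div, div_one, ← Real.rpow_add_one this.ne']
    congr 1
    ring
  rw [h1, tendsto_congr' h2]
  constructor
  · intro h
    by_contra! hr
    refine absurd (ge_of_tendsto h ?_) (not_le.2 (zero_lt_one (α := ℝ)))
    filter_upwards [eventually_ge_atTop 1] with n hn
    exact Real.one_le_rpow (by exact_mod_cast hn) (by linarith)
  · intro h
    exact (tendsto_rpow_neg_atTop (sub_pos.2 h)).comp tendsto_natCast_atTop_atTop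

/-- The bound on the excess risk, uniformly over the class of distributions, the compact set and
the sample size. -/
theorem exists_excessRisk_le {d : ℕ} {α β L c₀ r₀ C₀ μmin μmax : ℝ}
    (hα : 0 ≤ α) (hβ : 0 < β) (hL : 0 < L) (hc₀ : 0 < c₀) (hr₀ : 0 < r₀) (hC₀ : 0 < C₀)
    (hμmin : 0 < μmin) (hμ : μmin < μmax) {K : E d → ℝ} (hK : IsKernel β K) :
    ∃ C : ℝ, 0 < C ∧ ∀ 𝒞 : Set (E d), ∀ n : ℕ, 1 ≤ n →
      ∀ P ∈ classP d α β L c₀ r₀ C₀ μmin μmax 𝒞,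
        excessRisk (P : Measure (Z d)) (fStar n β K) ≤
          C * (n : ℝ) ^ (-(β * (1 + α) / (2 * β + d))) := by
  obtain ⟨C₁, c₂, n₀, hC₁, hc₂, H⟩ :=
    exists_pointwise_bound hβ hL hc₀ hr₀ hμmin (hμmin.trans hμ) hK
  set B₀ : ℝ := ∑' j : ℕ, ((j : ℝ) + 1) ^ (1 + α) * Real.exp (-(c₂ * (j : ℝ) ^ 2)) with hB₀
  have hB₀0 : 0 ≤ B₀ := tsum_nonneg fun j => by positivity
  set ρ : ℝ := β * (1 + α) / (2 * β + d) with hρ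
  have hρ0 : 0 ≤ ρ := by positivity
  refine ⟨2 * C₁ * C₀ * B₀ + ((n₀ : ℝ) + 1) ^ ρ, by positivity, ?_⟩
  rintro 𝒞 n hn P ⟨⟨η, hη, hηH, hmargin⟩, A, -, hAc, hAr, μ, -, hA, hA0, hPX⟩
  have hn' : (0 : ℝ) < n := by exact_mod_cast hn
  have hfm := measurable_fStar (d := d) hn (β := β) hK.measurable
  rw [add_mul]
  rcases lt_or_ge n n₀ with hlt | hge
  -- for small samples the excess risk is at most `1`
  · refine (excessRisk_le_one hfm).trans ((?_ : (1 : ℝ) ≤ _).trans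
      (le_add_of_nonneg_left (by positivity)))
    rw [Real.rpow_neg hn'.le, ← div_eq_mul_inv, one_le_div (by positivity)]
    refine Real.rpow_le_rpow hn'.le ?_ hρ0
    have : (n : ℝ) < n₀ := by exact_mod_cast hlt
    linarith
  refine le_trans ?_ (le_add_of_nonneg_right (by positivity))
  have hηm : Measurable η := hηH.1.continuous.measurable
  set h : ℝ := (n : ℝ) ^ (-(1 / (2 * β + d))) with hh
  have hh0 : 0 < h := Real.rpow_pos_of_pos hn' _
  have hδ : (h ^ β) ^ (1 + α) = (n : ℝ) ^ (-ρ) := by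
    rw [hh, ← Real.rpow_mul hn'.le, ← Real.rpow_mul hn'.le]
    congr 1
    rw [hρ]
    ring
  rw [excessRisk_eq hfm, ← hδ]
  have hη01 : ∀ᵐ x ∂(P : Measure (Z d)).fst, 0 ≤ η x ∧ η x ≤ 1 := by
    filter_upwards [hη] with x hx
    rw [hx]
    exact regressionFun_mem _ x
  refine integral_le_of_margin (g := fun x => η x - 1 / 2) (by fun_prop) ?_ hC₀.le hC₁.le hc₂
    (Real.rpow_pos_of_pos hh0 β) hmargin (fun x => by positivity) ?_
  · filter_upwards [hη01] with x hx
    rw [abs_le]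
    constructor <;> linarith
  · filter_upwards [hη, hη01, ae_fst_mem hAc hA0 hPX] with x hx hx01 hxA
    have h2 : |2 * regressionFun (P : Measure (Z d)) x - 1| = 2 * |η x - 1 / 2| := by
      rw [← hx, ← abs_two (α := ℝ), ← abs_mul, abs_two]
      congr 1
      ring
    rw [h2]
    by_cases hhalf : η x = 1 / 2
    · simp [hhalf]
    · have h3 : bayesRule (P : Measure (Z d)) x = plugIn η x := by
        simp only [bayesRule, plugIn, hx]
      rw [h3]
      exact mul_le_mul_of_nonneg_left (H n hge P η hη hηH A μ hAc hAr hA hA0 hPX x hxA hx01.1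
        hx01.2 hhalf) (by positivity)

end PlugIn

end

open PlugIn
theorem mainTheorem1 (d : ℕ) (hd : 1 ≤ d) (α β L c₀ r₀ C₀ μmin μmax : ℝ)
    (hα : 0 ≤ α) (hβ : 0 < β) (hL : 0 < L) (hc₀ : 0 < c₀) (hr₀ : 0 < r₀) (hC₀ : 0 < C₀)
    (hμmin : 0 < μmin) (hμ : μmin < μmax)
    (K : E d → ℝ) (hK : IsKernel β K) :
    -- the classifier is jointly measurable in the sample and the point
    (∀ n : ℕ, 1 ≤ n → Measurable fun p : (Fin n → Z d) × E d => fStar n β K p.1 p.2) ∧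
    -- the bound on the worst-case excess risk
    (∃ C : ℝ, 0 < C ∧ ∀ 𝒞 : Set (E d), IsCompact 𝒞 → ∀ n : ℕ, 1 ≤ n →
      ∀ P ∈ classP d α β L c₀ r₀ C₀ μmin μmax 𝒞,
        excessRisk (P : Measure (Z d)) (fStar n β K) ≤
          C * (n : ℝ) ^ (-(β * (1 + α) / (2 * β + d)))) ∧
    -- the rate is faster than `1/n` exactly when `(α - 1) β > d`
    ((fun n : ℕ => (n : ℝ) ^ (-(β * (1 + α) / (2 * β + d)))) =o[atTop] (fun n : ℕ => 1 / (n : ℝ)) ↔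
      (d : ℝ) < (α - 1) * β) := by
  refine ⟨fun n hn => measurable_fStar hn hK.measurable, ?_, ?_⟩
  · obtain ⟨C, hC, H⟩ := exists_excessRisk_le hα hβ hL hc₀ hr₀ hC₀ hμmin hμ hK
    exact ⟨C, hC, fun 𝒞 _ => H 𝒞⟩
  · rw [isLittleO_rpow_neg_iff, one_lt_div (by positivity)]
    constructor <;> intro h <;> linarith
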